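/- A zonotope $Z\subset\mathbb R^d$ is a Minkowski sum of finitely many line segments. For a finite set $R\subset\mathbb R^d$ let $\mathrm{Zon}(R):=\sum_{r\in R}\mathrm{conv}\{0,r\}$. There is exactly one finite set $\mathrm{Gen}(Z)\subset\mathbb R^d\setminus\{0\}$, the generators of $Z$, such that $\mathrm{Gen}(Z)\cap\mathbb R r=\{r,-r\}$ for each $r\in\mathrm{Gen}(Z)$ and $Z$ is a translate of $\mathrm{Zon}(\mathrm{Gen}(Z))$. A polytope is vertex-transitive if any of its vertices is mapped to any other by an isometry of $\mathbb R^d$ that preserves the polytope. For $r\neq 0$ let $T_r$ be the orthogonal reflection on the hyperplane $r^\perp$. A root system is a finite set $R\subset\mathbb R^d\setminus\{0\}$ with $T_rR=R$ for all $r\in R$; its Weyl group is the group generated by the $T_r$, $r\in R$. For a finite reflection group $\Gamma\subset\mathrm O(\mathbb R^d)$ (a finite group generated by such reflections), a $\Gamma$-permutahedron is a polytope on whose vertices $\Gamma$ acts regularly, i.e. transitively and freely. A subset $F\subseteq\mathrm{Gen}(Z)$ is a flat if $\mathrm{Gen}(Z)\cap\mathrm{span}(F)=F$; its dimension is that of $\mathrm{span}(F)$.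 A polytope counts as a face of itself. Theorem. (1) Let $Z\subset\mathbb R^d$ be a zonotope that is centred at the origin (that is, $-Z=Z$). If all $2$-dimensional faces of $Z$ are vertex-transitive, then $\mathrm{Gen}(Z)$ is a root system, and $Z$ is a $\Gamma$-permutahedron, where $\Gamma$ is the Weyl group of $\mathrm{Gen}(Z)$. (2) For any zonotope $Z\subset\mathbb R^d$ and any $2$-dimensional flat $F$ of $\mathrm{Gen}(Z)$ there is a $2$-dimensional face $\sigma$ of $Z$ with $\mathrm{Gen}(\sigma)=F$. (3) If $P\subset\mathbb R^d$ is a $2$-dimensional vertex-transitive zonotope, then $\mathrm{Gen}(P)$ is a root system that spans a $2$-dimensional space. -/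

import Mathlib

open scoped Pointwise

section ZonotopeDefinitions

variable {E : Type*} [NormedAddCommGroup E] [InnerProductSpace ℝ E]

/-- The dimension of a subset of a Euclidean space: the dimension of its affine hull. -/
noncomputable def affineDim (P : Set E) : ℕ :=
  Module.finrank ℝ (vectorSpan ℝ P)

/-- A polytope: the convex hull of a finite nonempty set of points. -/
def IsPolytope (P : Set E) : Prop :=
  ∃ V : Finset E, V.Nonempty ∧ P = convexHull ℝ (V : Set E)

/-- `σ` is a `k`-dimensional face of `P`: a nonempty set of maximisers over `P` of some linear
functional, whose affine hull has dimension `k` (`P` itself counts as a face). -/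
def IsFaceOfDim (k : ℕ) (σ P : Set E) : Prop :=
  σ.Nonempty ∧ IsExposed ℝ P σ ∧ affineDim σ = k

/-- `P` is vertex-transitive: any vertex is mapped to any other vertex by an isometry of the
ambient space that preserves `P`. The vertices are the extreme points. The isometry is allowed
to be affine, as a face need not be centred at the origin. -/
def IsVertexTransitive (P : Set E) : Prop :=
  ∀ v ∈ P.extremePoints ℝ, ∀ w ∈ P.extremePoints ℝ,
    ∃ T : E ≃ᵃⁱ[ℝ] E, T '' P = P ∧ T v = w

/-- A zonotope: a Minkowski sum of finitely many line segments. -/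
def IsZonotope (Z : Set E) : Prop :=
  ∃ (n : ℕ) (a b : Fin n → E), Z = ∑ i, segment ℝ (a i) (b i)

/-- The zonotope generated by a finite set `R`: the Minkowski sum of the segments `conv {0, r}`,
`r ∈ R`. If `R` is centrally symmetric, each pair `r, -r` contributes the
segment `conv {-r, r}`, and the result is centred at the origin. -/
def zon (R : Finset E) : Set E :=
  ∑ r ∈ R, segment ℝ (0 : E) r

/-- A finite set of nonzero vectors is reduced if each of its elements `r` and `-r` are
precisely the elements on the line through `r`. -/
def IsReducedSet (R : Finset E) : Prop :=
  (0 : E) ∉ R ∧ ∀ r ∈ R, (R : Set E) ∩ (Submodule.span ℝ {r} : Submodule ℝ E) = {r, -r}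

/-- `R` is a reduced set that generates `Z` up to translation. -/
def IsReducedGeneratingSet (R : Finset E) (Z : Set E) : Prop :=
  IsReducedSet R ∧ ∃ t : E, Z = t +ᵥ zon R

theorem mem_zon {R : Finset E} {x : E} :
    x ∈ zon R ↔ ∃ a : E → ℝ, (∀ r ∈ R, 0 ≤ a r ∧ a r ≤ 1) ∧ ∑ r ∈ R, a r • r = x := by
  classical
  rw [zon, Set.mem_finsetSum]
  constructor
  · rintro ⟨g, hg, rfl⟩
    have h : ∀ r, ∃ t : ℝ, r ∈ R → (0 ≤ t ∧ t ≤ 1) ∧ t • r = g r := by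
      intro r
      by_cases hr : r ∈ R
      · have := hg hr
        rw [segment_eq_image] at this
        obtain ⟨t, ht, h⟩ := this
        exact ⟨t, fun _ ↦ ⟨⟨ht.1, ht.2⟩, by simpa using h⟩⟩
      · exact ⟨0, fun h ↦ absurd h hr⟩
    choose a ha using h
    exact ⟨a, fun r hr ↦ (ha r hr).1, Finset.sum_congr rfl fun r hr ↦ (ha r hr).2⟩
  · rintro ⟨a, ha, rfl⟩
    refine ⟨fun r ↦ a r • r, fun {r} hr ↦ ?_, rfl⟩
    rw [segment_eq_image]
    exact ⟨a r, ⟨(ha r hr).1, (ha r hr).2⟩, by simp⟩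

theorem isGreatest_width {R : Finset E} {Z : Set E} {t : E} (hZ : Z = t +ᵥ zon R) (c : E) :
    IsGreatest {m : ℝ | ∃ x ∈ Z, ∃ y ∈ Z, m = inner ℝ c (x - y)}
      (∑ r ∈ R, |(inner ℝ c r : ℝ)|) := by
  subst hZ
  constructor
  · refine ⟨t +ᵥ ∑ r ∈ R, (if 0 ≤ (inner ℝ c r : ℝ) then (1 : ℝ) else 0) • r,
      Set.vadd_mem_vadd_set (mem_zon.2 ⟨_, fun r _ ↦ ?_, rfl⟩),
      t +ᵥ ∑ r ∈ R, (if 0 ≤ (inner ℝ c r : ℝ) then (0 : ℝ) else 1) • r,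
      Set.vadd_mem_vadd_set (mem_zon.2 ⟨_, fun r _ ↦ ?_, rfl⟩), ?_⟩
    · split_ifs <;> norm_num
    · split_ifs <;> norm_num
    · rw [vadd_eq_add, vadd_eq_add, add_sub_add_left_eq_sub, ← Finset.sum_sub_distrib, inner_sum]
      refine Finset.sum_congr rfl fun r _ ↦ ?_
      split_ifs with h
      · simp [abs_of_nonneg h]
      · simp [abs_of_neg (not_le.1 h)]
  · rintro m ⟨x, hx, y, hy, rfl⟩
    obtain ⟨x, hx, rfl⟩ := hx
    obtain ⟨y, hy, rfl⟩ := hy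
    obtain ⟨a, ha, rfl⟩ := mem_zon.1 hx
    obtain ⟨b, hb, rfl⟩ := mem_zon.1 hy
    simp only [vadd_eq_add, add_sub_add_left_eq_sub]
    rw [← Finset.sum_sub_distrib, inner_sum]
    refine Finset.sum_le_sum fun r hr ↦ ?_
    rw [← sub_smul, inner_smul_right]
    refine (le_abs_self _).trans ?_
    rw [abs_mul]
    refine mul_le_of_le_one_left (abs_nonneg _) ?_
    rw [abs_le]
    constructor <;> linarith [ha r hr, hb r hr, (ha r hr).1, (ha r hr).2, (hb r hr).1, (hb r hr).2]

theorem reducedSet_subset {R S : Finset E} (hR : IsReducedSet R) (hS : IsReducedSet S)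
    (h : ∀ c : E, ∑ r ∈ R, |(inner ℝ c r : ℝ)| = ∑ r ∈ S, |(inner ℝ c r : ℝ)|) : R ⊆ S := by
  classical
  intro r hr
  have hr0 : r ≠ 0 := fun h0 ↦ hR.1 (h0 ▸ hr)
  set L : Submodule ℝ E := Submodule.span ℝ {r} with hL
  -- a vector orthogonal to `r`, but to no other line of the two sets
  obtain ⟨c, hc, hcD⟩ : ∃ c ∈ Lᗮ, ∀ x : {x // x ∈ (R ∪ S).filter (fun x ↦ x ∉ L)},
      (innerₗ E x.1) c ≠ 0 := by
    refine Module.Dual.exists_forall_mem_ne_zero_of_forall_exists Lᗮ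
      (fun x : {x // x ∈ (R ∪ S).filter (fun x ↦ x ∉ L)} ↦ innerₗ E x.1) fun x ↦ ?_
    have hx : x.1 ∉ L := (Finset.mem_filter.1 x.2).2
    by_contra! hcon
    apply hx
    have hmem : x.1 ∈ Lᗮᗮ := by
      intro u hu
      rw [real_inner_comm]
      simpa using hcon u hu
    rwa [Submodule.orthogonal_orthogonal] at hmem
  have hcr : ∀ x ∈ L, (inner ℝ c x : ℝ) = 0 := fun x hx ↦ Submodule.inner_left_of_mem_orthogonal hx hc
  have hcx : ∀ x ∈ R ∪ S, x ∉ L → (inner ℝ c x : ℝ) ≠ 0 := fun x hx hxL ↦ by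
    have := hcD ⟨x, Finset.mem_filter.2 ⟨hx, hxL⟩⟩
    rwa [innerₗ_apply_apply, real_inner_comm] at this
  -- a small step
  obtain ⟨e, he, heD⟩ : ∃ e : ℝ, 0 < e ∧ ∀ x ∈ R ∪ S, x ∉ L →
      e * |(inner ℝ r x : ℝ)| ≤ |(inner ℝ c x : ℝ)| := by
    have : ∀ᶠ e in nhdsWithin (0 : ℝ) (Set.Ioi 0), ∀ x ∈ R ∪ S, x ∉ L →
        e * |(inner ℝ r x : ℝ)| ≤ |(inner ℝ c x : ℝ)| := by
      rw [Filter.eventually_all_finset]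
      intro x hx
      by_cases hxL : x ∈ L
      · exact Filter.Eventually.of_forall fun _ h ↦ absurd hxL h
      · have ht : Filter.Tendsto (fun e : ℝ ↦ e * |(inner ℝ r x : ℝ)|)
            (nhdsWithin 0 (Set.Ioi 0)) (nhds 0) := by
          have : Continuous (fun e : ℝ ↦ e * |(inner ℝ r x : ℝ)|) := by fun_prop
          simpa using (this.tendsto 0).mono_left nhdsWithin_le_nhds
        filter_upwards [ht.eventually (gt_mem_nhds (abs_pos.2 (hcx x hx hxL)))] with e he _
        exact he.le
    obtain ⟨e, he⟩ := (this.and self_mem_nhdsWithin).exists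
    exact ⟨e, he.2, he.1⟩
  have key : ∀ T : Finset E, T ⊆ R ∪ S →
      ∑ x ∈ T, |(inner ℝ (c + e • r) x : ℝ)| + ∑ x ∈ T, |(inner ℝ (c - e • r) x : ℝ)|
        - 2 * ∑ x ∈ T, |(inner ℝ c x : ℝ)|
      = 2 * e * ∑ x ∈ T.filter (fun x ↦ x ∈ L), |(inner ℝ r x : ℝ)| := by
    intro T hT
    rw [Finset.mul_sum, ← Finset.sum_add_distrib, ← Finset.sum_sub_distrib, Finset.mul_sum,
      Finset.sum_filter]
    refine Finset.sum_congr rfl fun x hx ↦ ?_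
    rw [inner_add_left, inner_sub_left, inner_smul_left]
    simp only [conj_trivial]
    split_ifs with hxL
    · rw [hcr x hxL, zero_add, zero_sub, abs_neg, abs_mul, abs_of_pos he]
      simp
      ring
    · have h1 := heD x (hT hx) hxL
      rw [show e * |(inner ℝ r x : ℝ)| = |e * (inner ℝ r x : ℝ)| by rw [abs_mul, abs_of_pos he]] at h1
      obtain ⟨h2, h3⟩ := abs_le.1 h1
      rcases abs_cases (inner ℝ c x : ℝ) with ⟨h4, h5⟩ | ⟨h4, h5⟩ <;> rw [h4] at h2 h3 ⊢
      · rw [abs_of_nonneg (by linarith), abs_of_nonneg (by linarith)]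
        ring
      · rw [abs_of_nonpos (by linarith), abs_of_nonpos (by linarith)]
        ring
  have hsum : ∑ x ∈ R.filter (fun x ↦ x ∈ L), |(inner ℝ r x : ℝ)|
      = ∑ x ∈ S.filter (fun x ↦ x ∈ L), |(inner ℝ r x : ℝ)| := by
    have h1 := key R Finset.subset_union_left
    have h2 := key S Finset.subset_union_right
    rw [h, h, h] at h1
    exact mul_left_cancel₀ (by positivity : (2 * e) ≠ 0) (h1.symm.trans h2)
  have pair : ∀ T : Finset E, IsReducedSet T → ∀ x ∈ T, x ∈ L →
      T.filter (fun x ↦ x ∈ L) = {x, -x} := by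
    intro T hT x hx hxL
    have hx0 : x ≠ 0 := fun h0 ↦ hT.1 (h0 ▸ hx)
    have hspan : Submodule.span ℝ {x} = L := by
      obtain ⟨k, rfl⟩ := Submodule.mem_span_singleton.1 hxL
      exact Submodule.span_singleton_smul_eq (IsUnit.mk0 k (left_ne_zero_of_smul hx0)) r
    ext y
    have := Set.ext_iff.1 (hT.2 x hx) y
    rw [hspan] at this
    simpa using this
  have hne : ∀ x : E, x ≠ 0 → x ≠ -x := fun x hx h ↦ hx (by
    have h2 : (2 : ℝ) • x = 0 := by rw [two_smul]; nth_rewrite 2 [h]; exact add_neg_cancel x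
    simpa using h2)
  have hrL : r ∈ L := Submodule.mem_span_singleton_self r
  rw [pair R hR r hr hrL, Finset.sum_pair (hne r hr0)] at hsum
  have hrr : 0 < (inner ℝ r r : ℝ) := real_inner_self_pos.2 hr0
  obtain ⟨s, hs⟩ : (S.filter (fun x ↦ x ∈ L)).Nonempty := by
    rw [Finset.nonempty_iff_ne_empty]
    intro h0
    rw [h0, Finset.sum_empty, inner_neg_right, abs_neg, abs_of_pos hrr] at hsum
    linarith
  obtain ⟨hsS, hsL⟩ := Finset.mem_filter.1 hs
  have hs0 : s ≠ 0 := fun h0 ↦ hS.1 (h0 ▸ hsS)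
  rw [pair S hS s hsS hsL, Finset.sum_pair (hne s hs0)] at hsum
  obtain ⟨k, rfl⟩ := Submodule.mem_span_singleton.1 hsL
  have hmem : r ∈ S.filter (fun x ↦ x ∈ L) := by
    rw [pair S hS _ hsS hsL]
    simp only [inner_neg_right, abs_neg, inner_smul_right, abs_mul, abs_of_pos hrr] at hsum
    have hk : |k| = 1 := by
      have : (|k| - 1) * (inner ℝ r r : ℝ) = 0 := by linarith
      rcases mul_eq_zero.1 this with h | h
      · linarith
      · exact absurd h hrr.ne'
    rcases (abs_eq zero_le_one).1 hk with rfl | rfl <;> simp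
  exact (Finset.mem_filter.1 hmem).1

theorem IsReducedGeneratingSet.unique {R S : Finset E} {Z : Set E}
    (hR : IsReducedGeneratingSet R Z) (hS : IsReducedGeneratingSet S Z) : R = S := by
  obtain ⟨hR, t, ht⟩ := hR
  obtain ⟨hS, u, hu⟩ := hS
  have h : ∀ c : E, ∑ r ∈ R, |(inner ℝ c r : ℝ)| = ∑ r ∈ S, |(inner ℝ c r : ℝ)| :=
    fun c ↦ (isGreatest_width ht c).unique (isGreatest_width hu c)
  exact (reducedSet_subset hR hS h).antisymm (reducedSet_subset hS hR fun c ↦ (h c).symm)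

theorem mem_segment_neg_self {v x : E} :
    x ∈ segment ℝ (-v) v ↔ ∃ t : ℝ, (-1 ≤ t ∧ t ≤ 1) ∧ t • v = x := by
  rw [segment_eq_image]
  constructor
  · rintro ⟨θ, ⟨h0, h1⟩, rfl⟩
    refine ⟨2 * θ - 1, ⟨by linarith, by linarith⟩, ?_⟩
    module
  · rintro ⟨t, ⟨h0, h1⟩, rfl⟩
    refine ⟨(t + 1) / 2, ⟨by linarith, by linarith⟩, ?_⟩
    dsimp only
    module

theorem segment_zero_add_segment_zero_neg (v : E) :
    segment ℝ (0 : E) v + segment ℝ (0 : E) (-v) = segment ℝ (-v) v := by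
  ext x
  rw [mem_segment_neg_self, Set.mem_add]
  simp only [segment_eq_image]
  constructor
  · rintro ⟨_, ⟨a, ⟨ha0, ha1⟩, rfl⟩, _, ⟨b, ⟨hb0, hb1⟩, rfl⟩, rfl⟩
    refine ⟨a - b, ⟨by linarith, by linarith⟩, ?_⟩
    module
  · rintro ⟨t, ⟨h0, h1⟩, rfl⟩
    refine ⟨_, ⟨(t + 1) / 2, ⟨by linarith, by linarith⟩, rfl⟩,
      _, ⟨(1 - t) / 2, ⟨by linarith, by linarith⟩, rfl⟩, ?_⟩
    module

theorem segment_add_segment_parallel {k : ℝ} (hk : 0 < k) (s : E) :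
    segment ℝ (-(k • s)) (k • s) + segment ℝ (-s) s
      = segment ℝ (-((k + 1) • s)) ((k + 1) • s) := by
  ext x
  rw [mem_segment_neg_self, Set.mem_add]
  simp only [mem_segment_neg_self]
  constructor
  · rintro ⟨_, ⟨a, ⟨ha0, ha1⟩, rfl⟩, _, ⟨b, ⟨hb0, hb1⟩, rfl⟩, rfl⟩
    refine ⟨(a * k + b) / (k + 1), ⟨?_, ?_⟩, ?_⟩
    · rw [le_div_iff₀ (by linarith)]
      nlinarith
    · rw [div_le_iff₀ (by linarith)]
      nlinarith
    · rw [smul_smul, smul_smul, ← add_smul]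
      congr 1
      field_simp
  · rintro ⟨t, ht, rfl⟩
    exact ⟨_, ⟨t, ht, rfl⟩, _, ⟨t, ht, rfl⟩, by module⟩

theorem exists_reducedSet_add_new {Q : Finset E} (hQ : IsReducedSet Q) {u : E} (hu : u ≠ 0)
    (h : ∀ x ∈ Q, x ∉ Submodule.span ℝ {u}) :
    ∃ R : Finset E, IsReducedSet R ∧ zon R = zon Q + segment ℝ (-u) u := by
  classical
  have hne : u ≠ -u := fun h ↦ hu (by
    have h2 : (2 : ℝ) • u = 0 := by rw [two_smul]; nth_rewrite 2 [h]; exact add_neg_cancel u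
    simpa using h2)
  have hmu : u ∈ Submodule.span ℝ {u} := Submodule.mem_span_singleton_self u
  have huQ : u ∉ Q := fun hx ↦ h u hx hmu
  have huQ' : -u ∉ Q := fun hx ↦ h _ hx (neg_mem hmu)
  have hline : ∀ y, (y ∈ insert u (insert (-u) Q) ∧ y ∈ Submodule.span ℝ {u}) ↔ y = u ∨ y = -u := by
    intro y
    simp only [Finset.mem_insert]
    constructor
    · rintro ⟨h1 | h1 | h1, h2⟩
      · exact Or.inl h1
      · exact Or.inr h1
      · exact absurd h2 (h y h1)
    · rintro (rfl | rfl)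
      · exact ⟨Or.inl rfl, hmu⟩
      · exact ⟨Or.inr (Or.inl rfl), neg_mem hmu⟩
  refine ⟨insert u (insert (-u) Q), ⟨?_, ?_⟩, ?_⟩
  · simp only [Finset.mem_insert, not_or]
    exact ⟨hu.symm, fun h ↦ hu (neg_eq_zero.1 h.symm), hQ.1⟩
  · intro r hr
    ext y
    simp only [Set.mem_inter_iff, SetLike.mem_coe, Set.mem_insert_iff,
      Set.mem_singleton_iff]
    rcases Finset.mem_insert.1 hr with rfl | hr
    · exact hline y
    rcases Finset.mem_insert.1 hr with rfl | hr
    · rw [← Set.neg_singleton, Submodule.span_neg, hline y, neg_neg, or_comm]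
    · have h1 := Set.ext_iff.1 (hQ.2 r hr) y
      simp only [Set.mem_inter_iff, SetLike.mem_coe, Set.mem_insert_iff,
        Set.mem_singleton_iff] at h1
      rw [← h1]
      have hr0 : r ≠ 0 := fun h0 ↦ hQ.1 (h0 ▸ hr)
      have h2 : ∀ z, z ≠ 0 → z ∈ Submodule.span ℝ {u} → z ∉ Submodule.span ℝ {r} := by
        intro z hz0 hz hz'
        obtain ⟨a, rfl⟩ := Submodule.mem_span_singleton.1 hz'
        have ha : a ≠ 0 := left_ne_zero_of_smul hz0
        exact h r hr (by simpa [smul_smul, ha] using Submodule.smul_mem _ a⁻¹ hz)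
      constructor
      · rintro ⟨h3, h4⟩
        rcases Finset.mem_insert.1 h3 with rfl | h3
        · exact absurd h4 (h2 _ hu hmu)
        rcases Finset.mem_insert.1 h3 with rfl | h3
        · exact absurd h4 (h2 _ (neg_ne_zero.2 hu) (neg_mem hmu))
        · exact ⟨h3, h4⟩
      · rintro ⟨h3, h4⟩
        exact ⟨Finset.mem_insert_of_mem (Finset.mem_insert_of_mem h3), h4⟩
  · have h1 : u ∉ insert (-u) Q := by
      rw [Finset.mem_insert, not_or]
      exact ⟨hne, huQ⟩
    rw [zon, Finset.sum_insert h1, Finset.sum_insert huQ', ← add_assoc,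
      segment_zero_add_segment_zero_neg, add_comm, zon]

theorem exists_reducedSet_add {R : Finset E} (hR : IsReducedSet R) (s : E) :
    ∃ R' : Finset E, IsReducedSet R' ∧ zon R' = zon R + segment ℝ (-s) s := by
  classical
  by_cases hs : s = 0
  · refine ⟨R, hR, ?_⟩
    rw [hs, neg_zero, segment_same, Set.singleton_zero, add_zero]
  by_cases h : ∀ x ∈ R, x ∉ Submodule.span ℝ {s}
  · exact exists_reducedSet_add_new hR hs h
  obtain ⟨r, hr, k, hk, rfl⟩ : ∃ r ∈ R, ∃ k : ℝ, 0 < k ∧ k • s = r := by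
    push Not at h
    obtain ⟨r, hr, hrs⟩ := h
    obtain ⟨k, rfl⟩ := Submodule.mem_span_singleton.1 hrs
    have hk : k ≠ 0 := fun hk ↦ hR.1 (by rw [hk, zero_smul] at hr; exact hr)
    rcases hk.lt_or_gt with hk | hk
    · refine ⟨-(k • s), ?_, -k, by linarith, by module⟩
      have : -(k • s) ∈ (R : Set E) ∩ (Submodule.span ℝ {k • s} : Submodule ℝ E) := by
        rw [hR.2 _ hr]
        simp
      exact this.1
    · exact ⟨_, hr, k, hk, rfl⟩
  have hk0 : k • s ≠ 0 := smul_ne_zero hk.ne' hs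
  have hspan : Submodule.span ℝ {k • s} = Submodule.span ℝ {s} :=
    Submodule.span_singleton_smul_eq (IsUnit.mk0 k hk.ne') s
  have hspan' : Submodule.span ℝ {(k + 1) • s} = Submodule.span ℝ {s} :=
    Submodule.span_singleton_smul_eq (IsUnit.mk0 (k + 1) (by linarith)) s
  have hne : k • s ≠ -(k • s) := fun h ↦ hk0 (by
    have h2 : (2 : ℝ) • (k • s) = 0 := by
      rw [two_smul]; nth_rewrite 2 [h]; exact add_neg_cancel (k • s)
    exact (smul_eq_zero.1 h2).resolve_left two_ne_zero)
  have hpair : ∀ y, (y ∈ R ∧ y ∈ Submodule.span ℝ {s}) ↔ y = k • s ∨ y = -(k • s) := by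
    intro y
    have := Set.ext_iff.1 (hR.2 _ hr) y
    rw [hspan] at this
    simpa using this
  set Q := R.filter (fun x ↦ x ∉ Submodule.span ℝ {s}) with hQdef
  have hQ : IsReducedSet Q := by
    refine ⟨fun h0 ↦ hR.1 (Finset.mem_filter.1 h0).1, fun x hx ↦ ?_⟩
    obtain ⟨hxR, hxs⟩ := Finset.mem_filter.1 hx
    rw [← hR.2 x hxR]
    ext y
    simp only [Set.mem_inter_iff, SetLike.mem_coe, hQdef, Finset.mem_filter]
    refine ⟨fun h ↦ ⟨h.1.1, h.2⟩, fun h ↦ ⟨⟨h.1, fun hys ↦ hxs ?_⟩, h.2⟩⟩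
    obtain ⟨a, rfl⟩ := Submodule.mem_span_singleton.1 h.2
    have ha : a ≠ 0 := fun ha ↦ hR.1 (by have := h.1; rwa [ha, zero_smul] at this)
    simpa [smul_smul, ha] using Submodule.smul_mem _ a⁻¹ hys
  have hRQ : R = insert (k • s) (insert (-(k • s)) Q) := by
    ext y
    rw [Finset.mem_insert, Finset.mem_insert, ← or_assoc, ← hpair y, hQdef, Finset.mem_filter]
    tauto
  have h1 : -(k • s) ∉ Q := fun h ↦
    (Finset.mem_filter.1 h).2 (neg_mem (Submodule.smul_mem _ k (Submodule.mem_span_singleton_self s)))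
  have h2 : k • s ∉ insert (-(k • s)) Q := by
    rw [Finset.mem_insert, not_or]
    exact ⟨hne, fun h ↦
      (Finset.mem_filter.1 h).2 (Submodule.smul_mem _ k (Submodule.mem_span_singleton_self s))⟩
  have hzon : zon R = zon Q + segment ℝ (-(k • s)) (k • s) := by
    rw [hRQ, zon, Finset.sum_insert h2, Finset.sum_insert h1, ← add_assoc,
      segment_zero_add_segment_zero_neg, add_comm, zon]
  obtain ⟨R', hR', hz⟩ := exists_reducedSet_add_new hQ (u := (k + 1) • s)
    (smul_ne_zero (by linarith) hs) (fun x hx ↦ by rw [hspan']; exact (Finset.mem_filter.1 hx).2)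
  exact ⟨R', hR', by rw [hz, hzon, add_assoc, segment_add_segment_parallel hk]⟩

theorem IsZonotope.exists_reducedGeneratingSet {Z : Set E} (hZ : IsZonotope Z) :
    ∃ R : Finset E, IsReducedGeneratingSet R Z := by
  classical
  obtain ⟨n, a, b, rfl⟩ := hZ
  suffices h : ∀ I : Finset (Fin n),
      ∃ R : Finset E, IsReducedGeneratingSet R (∑ i ∈ I, segment ℝ (a i) (b i)) from h _
  intro I
  induction I using Finset.induction_on with
  | empty => exact ⟨∅, ⟨by simp, by simp⟩, 0, by simp [zon]⟩
  | insert i I hi ih =>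
    obtain ⟨R, hR, t, ht⟩ := ih
    obtain ⟨R', hR', hz⟩ := exists_reducedSet_add hR ((1 / 2 : ℝ) • (b i - a i))
    refine ⟨R', hR', (1 / 2 : ℝ) • (a i + b i) + t, ?_⟩
    have hseg : segment ℝ (a i) (b i) = ((1 / 2 : ℝ) • (a i + b i)) +ᵥ
        segment ℝ (-((1 / 2 : ℝ) • (b i - a i))) ((1 / 2 : ℝ) • (b i - a i)) := by
      rw [← Set.image_vadd]
      simp only [vadd_eq_add]
      rw [segment_translate_image]
      congr 1 <;> module
    rw [Finset.sum_insert hi, ht, hz, hseg]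
    simp only [← Set.singleton_vadd, vadd_eq_add, ← Set.singleton_add_singleton]
    ac_rfl

theorem existsUnique_reducedGeneratingSet {Z : Set E} (hZ : IsZonotope Z) :
    ∃! R : Finset E, IsReducedGeneratingSet R Z := by
  obtain ⟨R, hR⟩ := hZ.exists_reducedGeneratingSet
  exact ⟨R, hR, fun S hS ↦ hS.unique hR⟩

/-- The set of generators of a zonotope `Z`: the elements of the reduced set that generates `Z` up
to translation. There is exactly one such set, see `existsUnique_reducedGeneratingSet`
and `zonGen_eq`. -/
def zonGen (Z : Set E) : Set E :=
  {r | ∃ R : Finset E, IsReducedGeneratingSet R Z ∧ r ∈ R}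

theorem zonGen_eq {R : Finset E} {Z : Set E} (hR : IsReducedGeneratingSet R Z) :
    zonGen Z = R := by
  ext r
  exact ⟨fun ⟨S, hS, hr⟩ ↦ hR.unique hS ▸ hr, fun hr ↦ ⟨R, hR, hr⟩⟩

/-- A flat of `R`: a subset that contains all elements of `R` in its linear span. -/
def IsFlatOf (F R : Set E) : Prop :=
  F ⊆ R ∧ R ∩ (Submodule.span ℝ F : Submodule ℝ E) ⊆ F

/-- The reflection `T_r` on the hyperplane `rᗮ`, for `r ≠ 0`. -/
noncomputable def hyperplaneReflection (r : E) : E ≃ₗᵢ[ℝ] E :=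
  (Submodule.span ℝ {r})ᗮ.reflection

/-- A root system: a finite set of nonzero vectors that is invariant under the reflections
on the hyperplanes orthogonal to its elements. -/
def IsRootSystem (R : Set E) : Prop :=
  R.Finite ∧ (0 : E) ∉ R ∧ ∀ r ∈ R, hyperplaneReflection r '' R = R

/-- The group generated by the reflections on the hyperplanes orthogonal to the elements
of `R`. If `R` is a root system, this is its Weyl group. -/
noncomputable def weylGroup (R : Set E) : Subgroup (E ≃ₗᵢ[ℝ] E) :=
  Subgroup.closure (hyperplaneReflection '' R)

/-- A finite reflection group: a finite group generated by hyperplane reflections. -/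
def IsFiniteReflectionGroup (Γ : Subgroup (E ≃ₗᵢ[ℝ] E)) : Prop :=
  Finite Γ ∧ ∃ R : Set E, R.Finite ∧ (0 : E) ∉ R ∧ Γ = weylGroup R

/-- `P` is a `Γ`-permutahedron: `P` is a polytope, `Γ` is a finite reflection group, and `Γ` acts
on the vertices of `P`, regularly (that is, transitively and freely). -/
structure IsPermutahedron (Γ : Subgroup (E ≃ₗᵢ[ℝ] E)) (P : Set E) : Prop where
  isPolytope : IsPolytope P
  isFiniteReflectionGroup : IsFiniteReflectionGroup Γ
  map_vertices : ∀ T ∈ Γ, ∀ v ∈ P.extremePoints ℝ, T v ∈ P.extremePoints ℝ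
  regular : ∀ v ∈ P.extremePoints ℝ, ∀ w ∈ P.extremePoints ℝ, ∃! T, T ∈ Γ ∧ T v = w

end ZonotopeDefinitions

/-! Write `R` for the generators of `Z`, a finite set with `R = -R`. A linear functional is
maximised on `zon R` term by term, so the face in direction `c` is a translate of the zonotope
generated by `R ∩ cᗮ` (`mem_zon_forall_inner_le_iff`). Hence the vertices are the points `posSum R
c`, one for each chamber of the arrangement of the hyperplanes `rᗮ`. If `c` is generic in the
orthogonal complement of a flat `F`, then `R ∩ cᗮ = F`, so `F` generates a face; this is (2).

For (3), an edge in direction `r` has end points `m - r` and `m + r`. Vertex-transitivity gives a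
linear isometry `A` that permutes `R` and maps the first to the second. The two have equal norm, so
`m` is orthogonal to `r`, and `T_r A` fixes `m - r`. In the plane, either `A` is `T_r`, or `A` is a
rotation with `T_r A T_r = A⁻¹`. In the latter case every element of `R` is, up to sign, of the form
`A ^ k (-r)`, and `T_r` maps this to `A ^ (-k) r`, which lies in `R`
(`hyperplaneReflection_mem_of_map_posSum`).

For (1), two non-parallel generators `r`, `s` lie in a common 2-dimensional flat, which generates a
2-face by (2); by the planar argument `T_r s` is a generator. So `R` is a root system, and it
remains to see that its Weyl group acts regularly on the chambers. Transitivity comes from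
maximising `⟪c, g c'⟫` over the group (`exists_forall_pos_inner_apply`), freeness from the exchange
condition (`exists_exchange`, `eq_one_of_mem_weylGroup`). -/

open scoped RealInnerProductSpace

/-! ### Reflections, generic vectors, and the faces and vertices of zonotopes. -/

section Basics

variable {E : Type*} [NormedAddCommGroup E] [InnerProductSpace ℝ E]

theorem ne_neg_self_of_ne_zero {x : E} (hx : x ≠ 0) : x ≠ -x := by
  intro h
  have h2 : (2 : ℝ) • x = 0 := by rw [two_smul]; nth_rewrite 2 [h]; exact add_neg_cancel x
  exact hx ((smul_eq_zero.1 h2).resolve_left two_ne_zero)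

theorem IsReducedSet.ne_zero {R : Finset E} (hR : IsReducedSet R) {r : E} (hr : r ∈ R) : r ≠ 0 :=
  fun h ↦ hR.1 (h ▸ hr)

theorem IsReducedSet.mem_span_iff {R : Finset E} (hR : IsReducedSet R) {r : E} (hr : r ∈ R)
    (s : E) : (s ∈ R ∧ s ∈ Submodule.span ℝ {r}) ↔ s = r ∨ s = -r := by
  simpa using Set.ext_iff.1 (hR.2 r hr) s

theorem IsReducedSet.neg_mem {R : Finset E} (hR : IsReducedSet R) {r : E} (hr : r ∈ R) :
    -r ∈ R :=
  ((hR.mem_span_iff hr (-r)).2 (Or.inr rfl)).1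

/-! ### Reflections -/

theorem hyperplaneReflection_apply (r x : E) :
    hyperplaneReflection r x = x - (2 * ⟪r, x⟫ / ⟪r, r⟫) • r := by
  rw [hyperplaneReflection, Submodule.reflection_orthogonal_apply,
    Submodule.reflection_singleton_apply, real_inner_self_eq_norm_sq]
  simp only [RCLike.ofReal_real_eq_id, id, two_smul, neg_sub]
  congr 1
  rw [← add_smul]
  congr 1
  ring

theorem hyperplaneReflection_self (r : E) : hyperplaneReflection r r = -r :=
  Submodule.reflection_orthogonalComplement_singleton_eq_neg r

theorem hyperplaneReflection_hyperplaneReflection (r x : E) :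
    hyperplaneReflection r (hyperplaneReflection r x) = x :=
  Submodule.reflection_reflection _ x

theorem hyperplaneReflection_mul_self (r : E) :
    hyperplaneReflection r * hyperplaneReflection r = 1 :=
  Submodule.reflection_mul_reflection _

theorem hyperplaneReflection_inv (r : E) :
    (hyperplaneReflection r)⁻¹ = hyperplaneReflection r :=
  Submodule.reflection_inv

theorem inner_hyperplaneReflection (r x y : E) :
    ⟪hyperplaneReflection r x, y⟫ = ⟪x, hyperplaneReflection r y⟫ := by
  conv_lhs => rw [← hyperplaneReflection_hyperplaneReflection r y]
  exact LinearIsometryEquiv.inner_map_map _ _ _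

theorem hyperplaneReflection_of_inner_eq_zero {r x : E} (h : ⟪r, x⟫ = 0) :
    hyperplaneReflection r x = x := by
  rw [hyperplaneReflection_apply, h]
  simp

theorem hyperplaneReflection_map (g : E ≃ₗᵢ[ℝ] E) (r : E) :
    hyperplaneReflection (g r) = g * hyperplaneReflection r * g⁻¹ := by
  ext x
  obtain ⟨y, rfl⟩ := g.surjective x
  have h : g⁻¹ (g y) = y := g.symm_apply_apply y
  rw [LinearIsometryEquiv.coe_mul, LinearIsometryEquiv.coe_mul, Function.comp, Function.comp, h,
    hyperplaneReflection_apply, hyperplaneReflection_apply, map_sub, map_smul,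
    g.inner_map_map, g.inner_map_map]

/-! ### Generic vectors -/

/-- As `Lᗮᗮ = L`, a vector outside `L` induces a nonzero functional on `Lᗮ`, and finitely many
nonzero functionals on a real vector space have a common non-zero. -/
theorem exists_mem_orthogonal_inner_ne_zero (L : Submodule ℝ E) [L.HasOrthogonalProjection]
    (D : Finset E) : ∃ c ∈ Lᗮ, ∀ x ∈ D, x ∉ L → ⟪c, x⟫ ≠ 0 := by
  classical
  obtain ⟨c, hc, hcD⟩ : ∃ c ∈ Lᗮ, ∀ x : {x // x ∈ D.filter (fun x ↦ x ∉ L)},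
      (innerₗ E x.1) c ≠ 0 := by
    refine Module.Dual.exists_forall_mem_ne_zero_of_forall_exists Lᗮ
      (fun x : {x // x ∈ D.filter (fun x ↦ x ∉ L)} ↦ innerₗ E x.1) fun x ↦ ?_
    have hx : x.1 ∉ L := (Finset.mem_filter.1 x.2).2
    by_contra! hcon
    apply hx
    have hmem : x.1 ∈ Lᗮᗮ := by
      intro u hu
      rw [real_inner_comm]
      simpa using hcon u hu
    rwa [Submodule.orthogonal_orthogonal] at hmem
  refine ⟨c, hc, fun x hx hxL ↦ ?_⟩
  have := hcD ⟨x, Finset.mem_filter.2 ⟨hx, hxL⟩⟩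
  rwa [innerₗ_apply_apply, real_inner_comm] at this

theorem exists_pos_mul_abs_lt {D : Finset E} {c : E} (r : E) (hc : ∀ x ∈ D, ⟪c, x⟫ ≠ 0) :
    ∃ e : ℝ, 0 < e ∧ ∀ x ∈ D, e * |⟪r, x⟫| < |⟪c, x⟫| := by
  have : ∀ᶠ e in nhdsWithin (0 : ℝ) (Set.Ioi 0), ∀ x ∈ D, e * |⟪r, x⟫| < |⟪c, x⟫| := by
    rw [Filter.eventually_all_finset]
    intro x hx
    have ht : Filter.Tendsto (fun e : ℝ ↦ e * |⟪r, x⟫|)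
        (nhdsWithin 0 (Set.Ioi 0)) (nhds 0) := by
      have : Continuous (fun e : ℝ ↦ e * |⟪r, x⟫|) := by fun_prop
      simpa using (this.tendsto 0).mono_left nhdsWithin_le_nhds
    exact ht.eventually (gt_mem_nhds (abs_pos.2 (hc x hx)))
  obtain ⟨e, he⟩ := (this.and self_mem_nhdsWithin).exists
  exact ⟨e, he.2, he.1⟩

/-- A generic point on the hyperplane `rᗮ`, and a vector along `r` so short that it crosses only
this hyperplane of the arrangement. -/
theorem IsReducedSet.exists_wall {R : Finset E} (hR : IsReducedSet R) {r : E} (hr : r ∈ R) :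
    ∃ c u : E, ⟪c, r⟫ = 0 ∧ 0 < ⟪u, r⟫ ∧ hyperplaneReflection r c = c ∧
      ∀ s ∈ R, s ≠ r → s ≠ -r → |⟪u, s⟫| < |⟪c, s⟫| := by
  classical
  obtain ⟨c, hc, hcD⟩ := exists_mem_orthogonal_inner_ne_zero (Submodule.span ℝ {r}) R
  have hcr : ⟪c, r⟫ = 0 :=
    Submodule.inner_left_of_mem_orthogonal (Submodule.mem_span_singleton_self r) hc
  obtain ⟨e, he, heD⟩ := exists_pos_mul_abs_lt (D := R.filter (· ∉ Submodule.span ℝ {r})) r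
    (c := c) fun x hx ↦ hcD x (Finset.mem_filter.1 hx).1 (Finset.mem_filter.1 hx).2
  refine ⟨c, e • r, hcr, ?_, ?_, fun s hs h1 h2 ↦ ?_⟩
  · rw [real_inner_smul_left]
    exact mul_pos he (real_inner_self_pos.2 (hR.ne_zero hr))
  · exact hyperplaneReflection_of_inner_eq_zero (by rw [real_inner_comm, hcr])
  · rw [real_inner_smul_left, abs_mul, abs_of_pos he]
    refine heD s (Finset.mem_filter.2 ⟨hs, fun hsr ↦ ?_⟩)
    rcases (hR.mem_span_iff hr s).1 ⟨hs, hsr⟩ with h | h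
    exacts [h1 h, h2 h]

/-! ### Faces of zonotopes -/

/-- `c` lies on none of the hyperplanes orthogonal to the elements of `R`. -/
def IsRegularFor (R : Finset E) (c : E) : Prop :=
  ∀ r ∈ R, ⟪c, r⟫ ≠ 0

/-- The sum of the elements of `R` on the positive side of `c`. -/
noncomputable def posSum (R : Finset E) (c : E) : E :=
  ∑ r ∈ R with 0 < ⟪c, r⟫, r

theorem posSum_eq (R : Finset E) (c : E) :
    posSum R c = ∑ r ∈ R, (if 0 < ⟪c, r⟫ then (1 : ℝ) else 0) • r := by
  simp [posSum, Finset.sum_filter, ite_smul]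

theorem posSum_mem_zon (R : Finset E) (c : E) : posSum R c ∈ zon R :=
  mem_zon.2 ⟨_, fun r _ ↦ by split_ifs <;> norm_num, (posSum_eq R c).symm⟩

theorem mul_inner_le_ite_mul_inner {a : ℝ} (h : 0 ≤ a ∧ a ≤ 1) (c r : E) :
    a * ⟪c, r⟫ ≤ (if 0 < ⟪c, r⟫ then (1 : ℝ) else 0) * ⟪c, r⟫ := by
  split_ifs with h' <;> nlinarith [h.1, h.2]

/-- Each summand `a r * ⟪c, r⟫` with `a r ∈ [0, 1]` is largest for `a r = 1` if `⟪c, r⟫` is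
positive, and for `a r = 0` otherwise. So `posSum R c` attains the support function. -/
theorem inner_le_inner_posSum {R : Finset E} {x : E} (hx : x ∈ zon R) (c : E) :
    ⟪c, x⟫ ≤ ⟪c, posSum R c⟫ := by
  obtain ⟨a, ha, rfl⟩ := mem_zon.1 hx
  rw [posSum_eq, inner_sum, inner_sum]
  simp only [real_inner_smul_right]
  exact Finset.sum_le_sum fun r hr ↦ mul_inner_le_ite_mul_inner (ha r hr) c r

/-- Equality in the termwise estimate determines the coefficient of every generator not orthogonal
to `c`; the remaining coefficients are free and sweep out the smaller zonotope. -/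
theorem mem_zon_forall_inner_le_iff {R : Finset E} {c x : E} :
    (x ∈ zon R ∧ ∀ y ∈ zon R, ⟪c, y⟫ ≤ ⟪c, x⟫) ↔
      x ∈ posSum R c +ᵥ zon (R.filter fun r ↦ ⟪c, r⟫ = 0) := by
  have key : ∀ a : E → ℝ, (∀ r ∈ R, ⟪c, r⟫ ≠ 0 → a r = if 0 < ⟪c, r⟫ then (1 : ℝ) else 0) →
      ∑ r ∈ R, a r • r = posSum R c + ∑ r ∈ R with ⟪c, r⟫ = 0, a r • r := by
    intro a h
    rw [posSum_eq, Finset.sum_filter, ← Finset.sum_add_distrib]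
    refine Finset.sum_congr rfl fun r hr ↦ ?_
    by_cases h0 : ⟪c, r⟫ = 0
    · simp [h0]
    · simp [h0, h r hr h0]
  constructor
  · rintro ⟨hx, hmax⟩
    have heq := (inner_le_inner_posSum hx c).antisymm (hmax _ (posSum_mem_zon R c))
    obtain ⟨a, ha, rfl⟩ := mem_zon.1 hx
    rw [posSum_eq, inner_sum, inner_sum] at heq
    simp only [real_inner_smul_right] at heq
    rw [Finset.sum_eq_sum_iff_of_le
      fun r hr ↦ mul_inner_le_ite_mul_inner (ha r hr) c r] at heq
    rw [key a fun r hr h0 ↦ mul_right_cancel₀ h0 (heq r hr)]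
    exact Set.vadd_mem_vadd_set (mem_zon.2 ⟨a, fun r hr ↦ ha r (Finset.mem_filter.1 hr).1, rfl⟩)
  · rintro ⟨z, hz, rfl⟩
    obtain ⟨a, ha, rfl⟩ := mem_zon.1 hz
    have hinner : ⟪c, posSum R c + ∑ r ∈ R with ⟪c, r⟫ = 0, a r • r⟫ = ⟪c, posSum R c⟫ := by
      rw [inner_add_right, inner_sum, Finset.sum_eq_zero, add_zero]
      intro r hr
      rw [real_inner_smul_right, (Finset.mem_filter.1 hr).2, mul_zero]
    refine ⟨?_, fun y hy ↦ ?_⟩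
    · refine mem_zon.2 ⟨fun r ↦ if ⟪c, r⟫ = 0 then a r else if 0 < ⟪c, r⟫ then 1 else 0,
        fun r hr ↦ ?_, ?_⟩
      · dsimp only
        split_ifs with h0
        · exact ha r (Finset.mem_filter.2 ⟨hr, h0⟩)
        all_goals norm_num
      · rw [key _ fun r hr h0 ↦ by rw [if_neg h0]]
        refine congrArg (posSum R c + ·) ?_
        refine Finset.sum_congr rfl fun r hr ↦ ?_
        rw [if_pos (Finset.mem_filter.1 hr).2]
    · dsimp only
      rw [vadd_eq_add, hinner]
      exact inner_le_inner_posSum hy c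

theorem mem_vadd_zon_forall_inner_le_iff {R : Finset E} {t c x : E} :
    (x ∈ t +ᵥ zon R ∧ ∀ y ∈ t +ᵥ zon R, ⟪c, y⟫ ≤ ⟪c, x⟫) ↔
      x ∈ (t + posSum R c) +ᵥ zon (R.filter fun r ↦ ⟪c, r⟫ = 0) := by
  obtain ⟨x, rfl⟩ : ∃ y, x = t +ᵥ y := ⟨-t +ᵥ x, by simp⟩
  rw [← vadd_eq_add, vadd_assoc, Set.vadd_mem_vadd_set_iff, Set.vadd_mem_vadd_set_iff,
    ← mem_zon_forall_inner_le_iff]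
  refine and_congr_right fun _ ↦ ?_
  rw [← Set.image_vadd, Set.forall_mem_image]
  simp [inner_add_right]

/-- A bounded set is not a proper translate of itself: the support functions in direction `t - u`
would differ by `⟪t - u, t - u⟫`. -/
theorem vadd_zon_injective (R : Finset E) {t u : E} (h : t +ᵥ zon R = u +ᵥ zon R) : t = u := by
  have key : ∀ {t u : E}, t +ᵥ zon R ⊆ u +ᵥ zon R → ⟪t - u, t - u⟫ ≤ 0 := by
    intro t u h
    obtain ⟨y, hy, h1⟩ := h (Set.vadd_mem_vadd_set (posSum_mem_zon R (t - u)))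
    have h2 := inner_le_inner_posSum hy (t - u)
    simp only [vadd_eq_add] at h1
    have h3 : t - u = y - posSum R (t - u) := by
      rw [sub_eq_sub_iff_add_eq_add, ← h1, add_comm]
    nth_rewrite 2 [h3]
    rw [inner_sub_right]
    linarith
  exact by
    have h0 := key h.le
    rw [real_inner_self_eq_norm_sq] at h0
    exact sub_eq_zero.1 (norm_eq_zero.1 (pow_eq_zero_iff two_ne_zero |>.1
      (h0.antisymm (sq_nonneg _))))

/-- Equal vertices come from the same chamber. -/
theorem pos_iff_of_posSum_eq {R : Finset E} {c c' : E} (hc : IsRegularFor R c)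
    (h : posSum R c = posSum R c') : ∀ r ∈ R, 0 < ⟪c, r⟫ ↔ 0 < ⟪c', r⟫ := by
  intro r hr
  have h1 := congrArg (fun x ↦ ⟪c, x⟫) h
  simp only [posSum_eq, inner_sum, real_inner_smul_right] at h1
  -- `posSum R c'` also maximises `⟪c, ·⟫`, so the two sums agree term by term; by regularity `⟪c,
  -- r⟫` can be cancelled.
  rw [eq_comm, Finset.sum_eq_sum_iff_of_le fun r hr ↦ mul_inner_le_ite_mul_inner
    (by split_ifs <;> norm_num) c r] at h1
  have := mul_right_cancel₀ (hc r hr) (h1 r hr)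
  split_ifs at this with h2 h3 h3 <;> first | tauto | norm_num at this

theorem posSum_congr {R : Finset E} {c c' : E} (h : ∀ r ∈ R, 0 < ⟪c, r⟫ ↔ 0 < ⟪c', r⟫) :
    posSum R c = posSum R c' := by
  rw [posSum, posSum, Finset.filter_congr h]

/-- In a centrally symmetric set, it suffices to compare the positive elements. -/
theorem pos_iff_of_forall_pos {R : Finset E} {c c' : E} (hR : ∀ r ∈ R, -r ∈ R)
    (hc : IsRegularFor R c) (h : ∀ r ∈ R, 0 < ⟪c, r⟫ → 0 < ⟪c', r⟫) :
    ∀ r ∈ R, 0 < ⟪c, r⟫ ↔ 0 < ⟪c', r⟫ := by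
  refine fun r hr ↦ ⟨h r hr, fun h' ↦ ?_⟩
  by_contra h0
  have := h (-r) (hR r hr) (by
    rw [inner_neg_right]
    exact neg_pos.2 (lt_of_le_of_ne (not_lt.1 h0) (hc r hr)))
  rw [inner_neg_right] at this
  linarith

theorem bijOn_of_forall_mem {R : Finset E} (g : E ≃ₗᵢ[ℝ] E) (h : ∀ r ∈ R, g r ∈ R) :
    Set.BijOn g R R := by
  have h1 : Set.MapsTo g R R := fun r hr ↦ h r hr
  exact ⟨h1, g.injective.injOn,
    Finset.surjOn_of_injOn_of_card_le g h1 g.injective.injOn le_rfl⟩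

theorem inv_mem_of_forall_mem {R : Finset E} {g : E ≃ₗᵢ[ℝ] E} (h : ∀ r ∈ R, g r ∈ R) :
    ∀ r ∈ R, g⁻¹ r ∈ R := by
  intro r hr
  obtain ⟨s, hs, rfl⟩ := (bijOn_of_forall_mem g h).surjOn hr
  have : g⁻¹ (g s) = s := g.symm_apply_apply s
  rw [this]
  exact hs

theorem map_posSum {R : Finset E} (g : E ≃ₗᵢ[ℝ] E) (h : ∀ r ∈ R, g r ∈ R) (c : E) :
    g (posSum R c) = posSum R (g c) := by
  rw [posSum, posSum, map_sum]
  refine Finset.sum_bij (fun r _ ↦ g r) (fun r hr ↦ ?_) (fun _ _ _ _ h ↦ g.injective h)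
    (fun s hs ↦ ?_) fun _ _ ↦ rfl
  · obtain ⟨h1, h2⟩ := Finset.mem_filter.1 hr
    exact Finset.mem_filter.2 ⟨h r h1, by rwa [g.inner_map_map]⟩
  · obtain ⟨h1, h2⟩ := Finset.mem_filter.1 hs
    obtain ⟨r, hr, rfl⟩ := (bijOn_of_forall_mem g h).surjOn h1
    exact ⟨r, Finset.mem_filter.2 ⟨hr, by rwa [g.inner_map_map] at h2⟩, rfl⟩

theorem IsRegularFor.map {R : Finset E} {g : E ≃ₗᵢ[ℝ] E} (h : ∀ r ∈ R, g r ∈ R) {c : E}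
    (hc : IsRegularFor R c) : IsRegularFor R (g c) := by
  intro r hr
  obtain ⟨s, hs, rfl⟩ := (bijOn_of_forall_mem g h).surjOn hr
  rw [g.inner_map_map]
  exact hc s hs

theorem image_zon [DecidableEq E] (g : E ≃ₗᵢ[ℝ] E) (R : Finset E) :
    g '' zon R = zon (R.image g) := by
  ext x
  obtain ⟨x, rfl⟩ := g.surjective x
  rw [g.injective.mem_set_image, mem_zon, mem_zon]
  simp only [Finset.forall_mem_image, Finset.sum_image g.injective.injOn]
  constructor
  · rintro ⟨a, ha, rfl⟩
    exact ⟨fun r ↦ a (g.symm r), by simpa using ha, by simp⟩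
  · rintro ⟨a, ha, h⟩
    exact ⟨fun r ↦ a (g r), by simpa using ha, g.injective (by simp [h])⟩

theorem image_zon_of_forall_mem {R : Finset E} (g : E ≃ₗᵢ[ℝ] E) (h : ∀ r ∈ R, g r ∈ R) :
    g '' zon R = zon R := by
  classical
  rw [image_zon]
  congr 1
  exact Finset.coe_injective (by
    rw [Finset.coe_image]
    exact (bijOn_of_forall_mem g h).image_eq)

theorem IsReducedSet.image [DecidableEq E] {R : Finset E} (hR : IsReducedSet R)
    (g : E ≃ₗᵢ[ℝ] E) : IsReducedSet (R.image g) := by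
  refine ⟨fun h ↦ ?_, ?_⟩
  · obtain ⟨r, hr, h⟩ := Finset.mem_image.1 h
    exact hR.ne_zero hr (by simpa using h)
  · simp only [Finset.forall_mem_image]
    intro r hr
    ext x
    obtain ⟨x, rfl⟩ := g.surjective x
    have h1 : g x ∈ Submodule.span ℝ {g r} ↔ x ∈ Submodule.span ℝ {r} := by
      simp only [Submodule.mem_span_singleton, ← map_smul, g.injective.eq_iff]
    have h2 : g x ∈ (R.image g : Finset E) ↔ x ∈ R := by
      simp
    simp only [Set.mem_inter_iff, SetLike.mem_coe, Set.mem_insert_iff, Set.mem_singleton_iff,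
      ← map_neg, g.injective.eq_iff, h1, h2]
    exact hR.mem_span_iff hr x

theorem isPolytope_vadd_zon (t : E) (R : Finset E) : IsPolytope (t +ᵥ zon R) := by
  classical
  have hfin : (∑ r ∈ R, ({0, r} : Set E)).Finite :=
    Finset.sum_induction _ Set.Finite (fun _ _ h h' ↦ h.add h') Set.finite_zero
      fun r _ ↦ Set.toFinite _
  refine ⟨(hfin.vadd_set (a := t)).toFinset, ?_, ?_⟩
  · rw [Set.Finite.toFinset_nonempty, Set.vadd_set_nonempty]
    exact ⟨∑ r ∈ R, 0, Set.finsetSum_mem_finsetSum _ _ _ fun r _ ↦ by simp⟩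
  · rw [Set.Finite.coe_toFinset, convexHull_vadd, convexHull_sum]
    simp only [convexHull_pair, zon]

/-- The functional strictly separates the vertex from the convex hull of the other spanning points.
Any other point of the polytope is a convex combination of `v` and a point of that hull, with
positive weight on the latter. -/
theorem IsPolytope.exists_inner_lt [FiniteDimensional ℝ E] {P : Set E} (hP : IsPolytope P)
    {v : E} (hv : v ∈ P.extremePoints ℝ) : ∃ c : E, ∀ x ∈ P, x ≠ v → ⟪c, x⟫ < ⟪c, v⟫ := by
  obtain ⟨V, -, rfl⟩ := hP
  have hvV : v ∈ (V : Set E) := extremePoints_convexHull_subset hv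
  set K := convexHull ℝ ((V : Set E) \ {v})
  have hvK : v ∉ K := by
    intro h
    have hmem := ((convex_convexHull ℝ (V : Set E)).mem_extremePoints_iff_mem_sdiff_convexHull_sdiff.1
      hv).2
    refine hmem (convexHull_mono ?_ h)
    exact fun x hx ↦ ⟨subset_convexHull _ _ hx.1, hx.2⟩
  have hfin : ((V : Set E) \ {v}).Finite := V.finite_toSet.subset Set.sdiff_subset
  obtain ⟨f, u, hfK, hfv⟩ := geometric_hahn_banach_closed_point (convex_convexHull ℝ _)
    (hfin.isCompact_convexHull ℝ).isClosed hvK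
  refine ⟨(InnerProductSpace.toDual ℝ E).symm f, fun x hx hxv ↦ ?_⟩
  rw [InnerProductSpace.toDual_symm_apply, InnerProductSpace.toDual_symm_apply]
  have hV : (V : Set E) = insert v ((V : Set E) \ {v}) := by
    rw [Set.insert_sdiff_singleton, Set.insert_eq_of_mem hvV]
  by_cases hne : ((V : Set E) \ {v}).Nonempty
  · rw [hV, convexHull_insert hne, convexJoin_singleton_left, Set.mem_iUnion₂] at hx
    obtain ⟨k, hk, a, b, ha, hb, hab, rfl⟩ := hx
    have hk' := (hfK k hk).trans hfv
    have hb0 : 0 < b := lt_of_le_of_ne hb fun h0 ↦ hxv (by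
      rw [← h0, add_zero] at hab
      rw [← h0, hab]
      simp)
    simp only [map_add, map_smul, smul_eq_mul]
    have : a = 1 - b := by linarith
    subst this
    nlinarith
  · rw [hV, Set.not_nonempty_iff_eq_empty.1 hne] at hx
    simp at hx
    exact absurd hx hxv

/-- The face in direction `c` is the single point `v`. A generator `r` orthogonal to `c` would
contribute both `0` and `r` to it. -/
theorem isRegularFor_of_inner_lt {R : Finset E} {t c v : E} (hv : v ∈ t +ᵥ zon R)
    (h : ∀ x ∈ t +ᵥ zon R, x ≠ v → ⟪c, x⟫ < ⟪c, v⟫) (hR0 : (0 : E) ∉ R) :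
    IsRegularFor R c ∧ v = t + posSum R c := by
  have huniq : ∀ z ∈ zon (R.filter fun r ↦ ⟪c, r⟫ = 0), t + posSum R c + z = v := by
    intro z hz
    by_contra hne
    have h1 := mem_vadd_zon_forall_inner_le_iff.2 (Set.vadd_mem_vadd_set (a := t + posSum R c) hz)
    exact (h _ h1.1 hne).not_ge (h1.2 v hv)
  have h0 : t + posSum R c + 0 = v :=
    huniq 0 (mem_zon.2 ⟨0, fun _ _ ↦ ⟨le_rfl, zero_le_one⟩, by simp⟩)
  classical
  refine ⟨fun r hr hcr ↦ hR0 ?_, by rw [← h0, add_zero]⟩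
  have hrm : r ∈ R.filter fun r ↦ ⟪c, r⟫ = 0 := Finset.mem_filter.2 ⟨hr, hcr⟩
  have h1 := huniq r (mem_zon.2 ⟨fun s ↦ if s = r then 1 else 0,
    fun s _ ↦ by dsimp only; split_ifs <;> norm_num, by simp [ite_smul, hr, hcr]⟩)
  rw [← h0, add_right_inj] at h1
  exact h1 ▸ hr

theorem mem_extremePoints_of_isRegularFor {R : Finset E} {c : E} (hc : IsRegularFor R c) (t : E) :
    t + posSum R c ∈ (t +ᵥ zon R).extremePoints ℝ := by
  have hempty : (R.filter fun r ↦ ⟪c, r⟫ = 0) = ∅ :=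
    Finset.filter_eq_empty_iff.2 fun {r} hr ↦ hc r hr
  have key : ∀ x, (x ∈ t +ᵥ zon R ∧ ∀ y ∈ t +ᵥ zon R, ⟪c, y⟫ ≤ ⟪c, x⟫) ↔
      x = t + posSum R c := by
    intro x
    rw [mem_vadd_zon_forall_inner_le_iff, hempty]
    simp [zon, Set.mem_vadd_set]
    exact eq_comm
  obtain ⟨h1, h2⟩ := (key _).2 rfl
  apply exposedPoints_subset_extremePoints
  rw [exposed_point_def]
  refine ⟨h1, innerSL ℝ c, fun y hy ↦ ⟨h2 y hy, fun h ↦ (key y).1 ⟨hy, fun z hz ↦ ?_⟩⟩⟩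
  exact (h2 z hz).trans h

/-- The vertices of a zonotope correspond to the chambers of the hyperplane arrangement of its
generators. -/
theorem mem_extremePoints_vadd_zon_iff [FiniteDimensional ℝ E] {R : Finset E} {t v : E}
    (hR0 : (0 : E) ∉ R) :
    v ∈ (t +ᵥ zon R).extremePoints ℝ ↔ ∃ c, IsRegularFor R c ∧ v = t + posSum R c := by
  constructor
  · intro hv
    obtain ⟨c, hc⟩ := (isPolytope_vadd_zon t R).exists_inner_lt hv
    exact ⟨c, isRegularFor_of_inner_lt hv.1 hc hR0⟩
  · rintro ⟨c, hc, rfl⟩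
    exact mem_extremePoints_of_isRegularFor hc t

end Basics

/-! ### Flats of generators and the faces that they generate. -/

section Flats

variable {E : Type*} [NormedAddCommGroup E] [InnerProductSpace ℝ E]

theorem vectorSpan_vadd_zon (t : E) (R : Finset E) :
    vectorSpan ℝ (t +ᵥ zon R) = Submodule.span ℝ (R : Set E) := by
  classical
  have h0 : (0 : E) ∈ zon R := mem_zon.2 ⟨0, fun _ _ ↦ ⟨le_rfl, zero_le_one⟩, by simp⟩
  rw [vectorSpan_vadd, vectorSpan_eq_span_vsub_set_right ℝ h0]
  simp only [vsub_eq_sub, sub_zero, Set.image_id']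
  apply le_antisymm <;> rw [Submodule.span_le]
  · intro x hx
    obtain ⟨a, -, rfl⟩ := mem_zon.1 hx
    exact Submodule.sum_mem _ fun r hr ↦ Submodule.smul_mem _ _ (Submodule.subset_span hr)
  · intro r hr
    refine Submodule.subset_span (mem_zon.2 ⟨fun s ↦ if s = r then 1 else 0,
      fun s _ ↦ by dsimp only; split_ifs <;> norm_num, ?_⟩)
    simpa [ite_smul] using fun h : r ∉ R ↦ absurd hr h

/-- A flat of generators of a zonotope is the set of generators of a face. -/
theorem exists_face_of_isFlatOf {R : Finset E} {Z : Set E} (hR : IsReducedGeneratingSet R Z)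
    {F : Set E} (hF : IsFlatOf F R) :
    ∃ σ : Set E, IsFaceOfDim (Module.finrank ℝ (Submodule.span ℝ F)) σ Z ∧
      ∃ G : Finset E, (G : Set E) = F ∧ IsReducedGeneratingSet G σ := by
  classical
  obtain ⟨hR, t, rfl⟩ := hR
  have hfin : F.Finite := R.finite_toSet.subset hF.1
  have : FiniteDimensional ℝ (Submodule.span ℝ F) := FiniteDimensional.span_of_finite ℝ hfin
  -- For such `c`, the generators orthogonal to `c` are those in the span of `F`, and these form `F`
  -- itself because `F` is a flat.
  obtain ⟨c, hc, hcR⟩ := exists_mem_orthogonal_inner_ne_zero (Submodule.span ℝ F) R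
  have hG : ((R.filter fun r ↦ ⟪c, r⟫ = 0 : Finset E) : Set E) = F := by
    ext r
    simp only [Finset.coe_filter, Set.mem_ofPred_eq]
    refine ⟨fun ⟨h1, h2⟩ ↦ hF.2 ⟨h1, ?_⟩, fun h ↦ ⟨hF.1 h, ?_⟩⟩
    · by_contra h
      exact hcR r h1 h h2
    · exact Submodule.inner_left_of_mem_orthogonal (Submodule.subset_span h) hc
  set G := R.filter fun r ↦ ⟪c, r⟫ = 0 with hGdef
  have hGred : IsReducedSet G := by
    refine ⟨fun h ↦ hR.1 (Finset.mem_filter.1 h).1, fun r hr ↦ ?_⟩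
    ext s
    have hs := hR.mem_span_iff (Finset.mem_filter.1 hr).1 s
    simp only [Set.mem_inter_iff, SetLike.mem_coe, Set.mem_insert_iff, Set.mem_singleton_iff]
    rw [← hs]
    refine and_congr_left fun h ↦ ⟨fun h ↦ (Finset.mem_filter.1 h).1, fun h' ↦ ?_⟩
    rw [← Finset.mem_coe, hG]
    exact hF.2 ⟨h', Submodule.span_mono (Set.singleton_subset_iff.2 (hG ▸ hr)) h⟩
  refine ⟨(t + posSum R c) +ᵥ zon G, ⟨?_, fun _ ↦ ⟨innerSL ℝ c, ?_⟩, ?_⟩, G, hG, hGred, _, rfl⟩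
  · exact ⟨_, Set.vadd_mem_vadd_set (posSum_mem_zon G 0)⟩
  · ext x
    exact mem_vadd_zon_forall_inner_le_iff.symm
  · rw [affineDim, vectorSpan_vadd_zon, hG]

end Flats

/-! ### Vertex-transitive polygons. -/

section Planar

variable {E : Type*} [NormedAddCommGroup E] [InnerProductSpace ℝ E]

/-- The symmetries of a vertex-transitive zonotope permute its generators, and act transitively
on the chambers. -/
theorem IsVertexTransitive.exists_map_posSum_eq {R : Finset E} {Z : Set E}
    (hR : IsReducedGeneratingSet R Z) (hZ : IsVertexTransitive Z) {c c' : E}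
    (hc : IsRegularFor R c) (hc' : IsRegularFor R c') :
    ∃ A : E ≃ₗᵢ[ℝ] E, (∀ r ∈ R, A r ∈ R) ∧ A (posSum R c) = posSum R c' := by
  classical
  have hR' := hR
  obtain ⟨hred, t, rfl⟩ := hR
  obtain ⟨T, hT, hTv⟩ := hZ _ (mem_extremePoints_of_isRegularFor hc t) _
    (mem_extremePoints_of_isRegularFor hc' t)
  set A := T.linearIsometryEquiv
  have hTA : ∀ x, T (t + x) = T t + A x := fun x ↦ by
    have := T.map_vadd t x
    rwa [vadd_eq_add, vadd_eq_add, add_comm, add_comm (A x)] at this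
  have himage : T '' (t +ᵥ zon R) = T t +ᵥ zon (R.image A) := by
    rw [← image_zon, ← Set.image_vadd, ← Set.image_vadd, Set.image_image, Set.image_image]
    simp only [vadd_eq_add, hTA]
  -- `R.image A` generates the same zonotope as `R`, up to translation, so uniqueness of the
  -- generators applies.
  have hRA : R.image A = R :=
    IsReducedGeneratingSet.unique ⟨hred.image A, T t, hT.symm.trans himage⟩ hR'
  have ht : T t = t := vadd_zon_injective R (by rw [← hT, himage, hRA])
  refine ⟨A, fun r hr ↦ hRA ▸ Finset.mem_image_of_mem A hr, ?_⟩
  rwa [hTA, ht, add_right_inj] at hTv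

/-- The form in which the dimension two enters the planar argument; it replaces coordinates and
angles. -/
theorem eq_zero_of_pairwise_orthogonal {W : Submodule ℝ E} (hW : Module.finrank ℝ W = 2)
    {x y z : E} (hx : x ∈ W) (hy : y ∈ W) (hz : z ∈ W) (hx0 : x ≠ 0) (hy0 : y ≠ 0)
    (hxy : ⟪x, y⟫ = 0) (hxz : ⟪x, z⟫ = 0) (hyz : ⟪y, z⟫ = 0) : z = 0 := by
  by_contra hz0
  have : FiniteDimensional ℝ W := FiniteDimensional.of_finrank_pos (by omega)
  have hli : LinearIndependent ℝ (![⟨x, hx⟩, ⟨y, hy⟩, ⟨z, hz⟩] : Fin 3 → W) := by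
    refine linearIndependent_of_ne_zero_of_inner_eq_zero (fun i ↦ ?_) fun i j hij ↦ ?_
    · fin_cases i <;> simpa
    · have h1 := (real_inner_comm x y).trans hxy
      have h2 := (real_inner_comm x z).trans hxz
      have h3 := (real_inner_comm y z).trans hyz
      fin_cases i <;> fin_cases j <;> simp_all
  have := hli.fintype_card_le_finrank
  rw [hW, Fintype.card_fin] at this
  omega

/-- The vectors `v`, `B w - w` and `B w + w` are pairwise orthogonal, the last two because `B`
preserves norms, so they cannot all be nonzero in a plane. -/
theorem map_eq_self_or_eq_neg {W : Submodule ℝ E} (hW : Module.finrank ℝ W = 2)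
    {B : E ≃ₗᵢ[ℝ] E} (hB : ∀ x ∈ W, B x ∈ W) {v : E} (hv : v ∈ W) (hv0 : v ≠ 0) (hBv : B v = v)
    {w : E} (hw : w ∈ W) (hvw : ⟪v, w⟫ = 0) : B w = w ∨ B w = -w := by
  have hvB : ⟪v, B w⟫ = 0 := by
    rw [← hBv, B.inner_map_map, hvw]
  rw [or_iff_not_imp_left]
  intro hne
  rw [eq_neg_iff_add_eq_zero]
  refine eq_zero_of_pairwise_orthogonal hW hv (W.sub_mem (hB w hw) hw) (W.add_mem (hB w hw) hw)
    hv0 (sub_ne_zero.2 hne) ?_ ?_ ?_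
  · rw [inner_sub_right, hvB, hvw, sub_zero]
  · rw [inner_add_right, hvB, hvw, add_zero]
  · rw [inner_sub_left, inner_add_right, inner_add_right, B.inner_map_map, real_inner_comm (B w) w]
    ring

theorem map_map_eq_self {W : Submodule ℝ E} (hW : Module.finrank ℝ W = 2)
    {B : E ≃ₗᵢ[ℝ] E} (hB : ∀ x ∈ W, B x ∈ W) {v : E} (hv : v ∈ W) (hv0 : v ≠ 0) (hBv : B v = v)
    {w : E} (hw : w ∈ W) : B (B w) = w := by
  set k := ⟪v, w⟫ / ⟪v, v⟫
  have hk : ⟪v, w - k • v⟫ = 0 := by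
    rw [inner_sub_right, real_inner_smul_right, div_mul_cancel₀ _ (inner_self_ne_zero.2 hv0),
      sub_self]
  have h : B (B (w - k • v)) = w - k • v := by
    rcases map_eq_self_or_eq_neg hW hB hv hv0 hBv (W.sub_mem hw (W.smul_mem k hv)) hk with h | h
    · rw [h, h]
    · rw [h, map_neg, h, neg_neg]
  simpa [hBv] using h

/-- The step `u` from the point `c` on the wall `rᗮ` makes `r` positive and changes no other sign,
except that of `-r`. Applied to `-r` and `-u`, this describes the chamber on the other side of the
wall. -/
theorem pos_inner_add_iff {R : Finset E} {r c u : E} (hcr : ⟪c, r⟫ = 0) (hur : 0 < ⟪u, r⟫)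
    (h : ∀ s ∈ R, s ≠ r → s ≠ -r → |⟪u, s⟫| < |⟪c, s⟫|) :
    ∀ s ∈ R, 0 < ⟪c + u, s⟫ ↔ s = r ∨ 0 < ⟪c, s⟫ := by
  intro s hs
  rw [inner_add_left]
  by_cases h1 : s = r
  · subst h1
    simp [hcr, hur]
  by_cases h2 : s = -r
  · subst h2
    simp [hcr, h1, hur.le]
  have h3 := h s hs h1 h2
  rw [or_iff_right h1]
  rcases abs_cases ⟪c, s⟫ with h4 | h4 <;> rcases abs_cases ⟪u, s⟫ with h5 | h5 <;>
    constructor <;> intro h6 <;> linarith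

theorem isRegularFor_add {R : Finset E} {r c u : E} (hcr : ⟪c, r⟫ = 0) (hur : 0 < ⟪u, r⟫)
    (h : ∀ s ∈ R, s ≠ r → s ≠ -r → |⟪u, s⟫| < |⟪c, s⟫|) : IsRegularFor R (c + u) := by
  intro s hs
  rw [inner_add_left]
  by_cases h1 : s = r
  · subst h1
    simp [hcr, hur.ne']
  by_cases h2 : s = -r
  · subst h2
    simp [hcr, hur.ne']
  intro h0
  have h3 := h s hs h1 h2
  rw [eq_neg_of_add_eq_zero_left h0, abs_neg] at h3
  exact h3.false

/-- With its counterpart for `-r` and `-u`, this exhibits the two end points of an edge as `m + r`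
and `m - r`, where `m = posSum R c`. -/
theorem posSum_add {R : Finset E} {r c u : E} (hr : r ∈ R) (hcr : ⟪c, r⟫ = 0) (hur : 0 < ⟪u, r⟫)
    (h : ∀ s ∈ R, s ≠ r → s ≠ -r → |⟪u, s⟫| < |⟪c, s⟫|) :
    posSum R (c + u) = r + posSum R c := by
  classical
  have h1 : R.filter (fun s ↦ 0 < ⟪c + u, s⟫) = insert r (R.filter fun s ↦ 0 < ⟪c, s⟫) := by
    ext s
    rw [Finset.mem_insert, Finset.mem_filter, Finset.mem_filter]
    constructor
    · rintro ⟨hs, hp⟩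
      exact ((pos_inner_add_iff hcr hur h s hs).1 hp).imp_right fun hp ↦ ⟨hs, hp⟩
    · rintro (rfl | ⟨hs, hp⟩)
      · exact ⟨hr, (pos_inner_add_iff hcr hur h s hr).2 (Or.inl rfl)⟩
      · exact ⟨hs, (pos_inner_add_iff hcr hur h s hs).2 (Or.inr hp)⟩
  rw [posSum, h1, Finset.sum_insert (by simp [hcr]), posSum]

/-- Every positive element can be moved back across the wall by a power of a symmetry without
fixed points. -/
theorem exists_pow_apply_eq {R : Finset E} {W : Submodule ℝ E} (hRW : ∀ r ∈ R, r ∈ W)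
    {A : E ≃ₗᵢ[ℝ] E} (hA : ∀ r ∈ R, A r ∈ R) (hfix : ∀ x ∈ W, A x = x → x = 0) {c r : E}
    (hcross : ∀ s ∈ R, (A s = r ∨ 0 < ⟪c, A s⟫) → s = -r ∨ 0 < ⟪c, s⟫)
    {s : E} (hs : s ∈ R) (hsc : s = r ∨ 0 < ⟪c, s⟫) : ∃ k : ℕ, s = (A ^ k) (-r) := by
  by_contra! hcon
  -- The backward orbit of `s`. As it avoids `-r`, `hcross` keeps it among the elements positive on
  -- `c`, from index 1 on: `s` itself may be `r`, which is orthogonal to `c`.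
  set f : ℕ → E := fun k ↦ (A⁻¹ ^ k) s with hf
  have hAf : ∀ k, A (f (k + 1)) = f k := by
    intro k
    have : A * A⁻¹ ^ (k + 1) = A⁻¹ ^ k := by
      rw [pow_succ', mul_inv_cancel_left]
    exact DFunLike.congr_fun this s
  have hfR : ∀ k, f k ∈ R := by
    intro k
    induction k with
    | zero => exact hs
    | succ k ih =>
      have := inv_mem_of_forall_mem hA _ ih
      rwa [← hAf k, show A⁻¹ (A (f (k + 1))) = f (k + 1) from A.symm_apply_apply _] at this
  have hfr : ∀ k, f k ≠ -r := by
    intro k hk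
    refine hcon k ?_
    rw [← hk]
    have : A ^ k * A⁻¹ ^ k = 1 := by rw [inv_pow, mul_inv_cancel]
    exact (DFunLike.congr_fun this s).symm
  have hstep : ∀ k, (f k = r ∨ 0 < ⟪c, f k⟫) → 0 < ⟪c, f (k + 1)⟫ := fun k hk ↦
    (hcross _ (hfR _) (by rwa [hAf])).resolve_left (hfr _)
  have hpos : ∀ k, 0 < ⟪c, f (k + 1)⟫ := by
    intro k
    induction k with
    | zero => exact hstep 0 hsc
    | succ k ih => exact hstep _ (Or.inr ih)
  obtain ⟨i, j, hij, hfij⟩ := R.finite_toSet.exists_lt_map_eq_of_forall_mem (f := f) hfR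
  -- The sum over a period of the orbit is fixed by `A`, but has positive inner product with `c`.
  set y := ∑ k ∈ Finset.range (j - i), f (i + k + 1) with hy
  have hy0 : 0 < ⟪c, y⟫ := by
    rw [hy, inner_sum]
    exact Finset.sum_pos (fun k _ ↦ hpos _) (Finset.nonempty_range_iff.2 (by omega))
  have hAy : A y = y := by
    rw [hy, map_sum, ← sub_eq_zero, ← Finset.sum_sub_distrib]
    simp only [hAf]
    have := Finset.sum_range_sub' (fun k ↦ f (i + k)) (j - i)
    simp only [← add_assoc] at this
    rw [this, add_zero, Nat.add_sub_cancel' hij.le, hfij, sub_self]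
  have := hfix y (W.sum_mem fun k _ ↦ hRW _ (hfR _)) hAy
  rw [this, inner_zero_right] at hy0
  exact hy0.false

/-- In the plane, a symmetry of the arrangement that moves one of the vertices of an edge in
direction `r` to the other one forces the reflection in `r` to be a symmetry. -/
theorem hyperplaneReflection_mem_of_map_posSum {R : Finset E} (hR : IsReducedSet R)
    (hdim : Module.finrank ℝ (Submodule.span ℝ (R : Set E)) = 2) {r c u : E} (hr : r ∈ R)
    (hcr : ⟪c, r⟫ = 0) (hur : 0 < ⟪u, r⟫)
    (h : ∀ s ∈ R, s ≠ r → s ≠ -r → |⟪u, s⟫| < |⟪c, s⟫|) {A : E ≃ₗᵢ[ℝ] E}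
    (hA : ∀ r ∈ R, A r ∈ R) (hAv : A (posSum R (c + -u)) = posSum R (c + u)) :
    ∀ s ∈ R, hyperplaneReflection r s ∈ R := by
  set W := Submodule.span ℝ (R : Set E) with hWdef
  have hRW : ∀ s ∈ R, s ∈ W := fun s hs ↦ Submodule.subset_span hs
  have hr0 := hR.ne_zero hr
  have hcr' : ⟪c, -r⟫ = 0 := by rw [inner_neg_right, hcr, neg_zero]
  have hur' : 0 < ⟪-u, -r⟫ := by rwa [inner_neg_neg]
  have h' : ∀ s ∈ R, s ≠ -r → s ≠ - -r → |⟪-u, s⟫| < |⟪c, s⟫| := by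
    intro s hs h1 h2
    rw [inner_neg_left, abs_neg]
    exact h s hs (by simpa using h2) h1
  have hp := pos_inner_add_iff hcr hur h
  have hm := pos_inner_add_iff hcr' hur' h'
  have hvp := posSum_add hr hcr hur h
  have hvm := posSum_add (hR.neg_mem hr) hcr' hur' h'
  -- `A` takes the chamber of `c - u` to that of `c + u`. If `P` denotes the elements positive on
  -- `c`, the positive elements of these chambers are `P` with `-r` and `P` with `r`.
  have hcross : ∀ s ∈ R, (A s = r ∨ 0 < ⟪c, A s⟫) → s = -r ∨ 0 < ⟪c, s⟫ := by
    intro s hs hAs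
    rw [map_posSum A hA] at hAv
    rw [← hm s hs, ← A.inner_map_map,
      pos_iff_of_posSum_eq ((isRegularFor_add hcr' hur' h').map hA) hAv _ (hA s hs)]
    exact (hp _ (hA s hs)).2 hAs
  set m := posSum R c
  set v := posSum R (c + -u) with hvdef
  have hmW : m ∈ W := W.sum_mem fun s hs ↦ hRW s (Finset.mem_filter.1 hs).1
  have hvW : v ∈ W := hvm ▸ W.add_mem (W.neg_mem (hRW r hr)) hmW
  -- The isometry `A` maps `-r + m` to `r + m`, so both have the same norm.
  have hrm : ⟪r, m⟫ = 0 := by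
    have h1 : ⟪r + m, r + m⟫ = ⟪-r + m, -r + m⟫ := by
      rw [← hvp, ← hvm, ← hAv, A.inner_map_map]
    simp only [inner_add_left, inner_add_right, inner_neg_left, inner_neg_right,
      real_inner_comm r m] at h1
    linarith
  have hrv : ⟪r, v⟫ ≠ 0 := by
    rw [hvm, inner_add_right, inner_neg_right, hrm, add_zero, neg_ne_zero]
    exact inner_self_ne_zero.2 hr0
  have hv0 : v ≠ 0 := fun h0 ↦ hrv (by rw [h0, inner_zero_right])
  have hTv : hyperplaneReflection r (A v) = v := by
    rw [hAv, hvp, hvm, map_add, hyperplaneReflection_self,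
      hyperplaneReflection_of_inner_eq_zero hrm]
  have hTW : ∀ x ∈ W, hyperplaneReflection r x ∈ W := by
    intro x hx
    rw [hyperplaneReflection_apply]
    exact W.sub_mem hx (W.smul_mem _ (hRW r hr))
  have hAW : ∀ x ∈ W, A x ∈ W := by
    intro x hx
    have : W ≤ W.comap A.toLinearEquiv.toLinearMap :=
      Submodule.span_le.2 fun s hs ↦ hRW _ (hA s hs)
    exact this hx
  set B : E ≃ₗᵢ[ℝ] E := hyperplaneReflection r * A with hBdef
  have hBapp : ∀ x, B x = hyperplaneReflection r (A x) := fun _ ↦ rfl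
  have hBW : ∀ x ∈ W, B x ∈ W := fun x hx ↦ hTW _ (hAW x hx)
  have hBB : ∀ x ∈ W, B (B x) = x := fun x hx ↦ map_map_eq_self hdim hBW hvW hv0 hTv hx
  -- `B` fixes `v`. If it also fixes the vectors of `W` orthogonal to `v`, then `A` coincides with
  -- the reflection on `W`. Otherwise `B` is a reflection of the plane and `A` a rotation.
  by_cases hB : ∀ w ∈ W, ⟪v, w⟫ = 0 → B w = w
  · intro s hs
    have h1 : ⟪v, s - (⟪v, s⟫ / ⟪v, v⟫) • v⟫ = 0 := by
      rw [inner_sub_right, real_inner_smul_right, div_mul_cancel₀ _ (inner_self_ne_zero.2 hv0),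
        sub_self]
    have h2 := hB _ (W.sub_mem (hRW s hs) (W.smul_mem _ hvW)) h1
    rw [map_sub, map_smul, show B v = v from hTv, sub_left_inj] at h2
    rw [← h2, hBapp, hyperplaneReflection_hyperplaneReflection]
    exact hA s hs
  push Not at hB
  obtain ⟨w, hwW, hvw, hBw⟩ := hB
  have hBw' := (map_eq_self_or_eq_neg hdim hBW hvW hv0 hTv hwW hvw).resolve_left hBw
  have hw0 : w ≠ 0 := fun h0 ↦ hBw (by rw [h0, map_zero])
  -- For a fixed vector `x` of `A`, the difference `x - B x` is a multiple of `r` and orthogonal to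
  -- `v`. Since `⟪r, v⟫ ≠ 0`, it vanishes, so `x` is orthogonal to `r`. As `B x = x` and `B w = -w`,
  -- `x` is also orthogonal to `w`, hence a multiple of `v`, hence zero.
  have hfix : ∀ x ∈ W, A x = x → x = 0 := by
    intro x hx hAx
    have hBx : B x = hyperplaneReflection r x := by rw [hBapp, hAx]
    have h1 : ⟪v, x - B x⟫ = 0 := by
      have h2 := B.inner_map_map v x
      rw [show B v = v from hTv] at h2
      rw [inner_sub_right, h2, sub_self]
    have hrx : ⟪r, x⟫ = 0 := by
      rw [hBx, hyperplaneReflection_apply, sub_sub_cancel, real_inner_smul_right,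
        real_inner_comm r v, mul_eq_zero, or_iff_left hrv, div_eq_zero_iff,
        or_iff_left (inner_self_ne_zero.2 hr0)] at h1
      linarith
    have hBx' : B x = x := by rw [hBx, hyperplaneReflection_of_inner_eq_zero hrx]
    have hwx : ⟪w, x⟫ = 0 := by
      have h2 := B.inner_map_map w x
      rw [hBw', hBx', inner_neg_left] at h2
      linarith
    have h3 : x - (⟪v, x⟫ / ⟪v, v⟫) • v = 0 := by
      refine eq_zero_of_pairwise_orthogonal hdim hvW hwW
        (W.sub_mem hx (W.smul_mem _ hvW)) hv0 hw0 hvw ?_ ?_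
      · rw [inner_sub_right, real_inner_smul_right,
          div_mul_cancel₀ _ (inner_self_ne_zero.2 hv0), sub_self]
      · rw [inner_sub_right, real_inner_smul_right, hwx, real_inner_comm v w, hvw]
        simp
    rw [sub_eq_zero] at h3
    rw [h3, real_inner_smul_right, mul_eq_zero, or_iff_left hrv] at hrx
    rw [h3, hrx, zero_smul]
  -- This is `B (B x) = x`, rewritten: the reflection conjugates the rotation `A` to its inverse.
  have hcomm : ∀ x ∈ W, hyperplaneReflection r (A x) = A⁻¹ (hyperplaneReflection r x) := by
    intro x hx
    apply A.injective
    rw [show A (A⁻¹ (hyperplaneReflection r x)) = hyperplaneReflection r x from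
      A.apply_symm_apply _]
    have := congrArg (hyperplaneReflection r) (hBB x hx)
    rwa [hBapp, hBapp, hyperplaneReflection_hyperplaneReflection] at this
  have hpow : ∀ (k : ℕ) (x : E), x ∈ R → hyperplaneReflection r x ∈ R →
      hyperplaneReflection r ((A ^ k) x) ∈ R ∧ (A ^ k) x ∈ R := by
    intro k x hx hTx
    induction k with
    | zero => exact ⟨hTx, hx⟩
    | succ k ih =>
      rw [pow_succ']
      change hyperplaneReflection r (A ((A ^ k) x)) ∈ R ∧ A ((A ^ k) x) ∈ R
      rw [hcomm _ (hRW _ ih.2)]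
      exact ⟨inv_mem_of_forall_mem hA _ ih.1, hA _ ih.2⟩
  have hpos : ∀ s ∈ R, (s = r ∨ 0 < ⟪c, s⟫) → hyperplaneReflection r s ∈ R := by
    intro s hs hsc
    obtain ⟨k, rfl⟩ := exists_pow_apply_eq hRW hA hfix hcross hs hsc
    refine (hpow k _ (hR.neg_mem hr) ?_).1
    rw [map_neg, hyperplaneReflection_self, neg_neg]
    exact hr
  intro s hs
  rcases (isRegularFor_add hcr hur h s hs).lt_or_gt with hneg | hsp
  · have h1 := hpos (-s) (hR.neg_mem hs) ((hp _ (hR.neg_mem hs)).1 (by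
      rw [inner_neg_right]
      exact neg_pos.2 hneg))
    rw [map_neg] at h1
    simpa using hR.neg_mem h1
  · exact hpos s hs ((hp s hs).1 hsp)

/-- The generators of a vertex-transitive polygon are invariant under the reflections in them. -/
theorem IsVertexTransitive.hyperplaneReflection_mem {R : Finset E} {P : Set E}
    (hR : IsReducedGeneratingSet R P) (hP : IsVertexTransitive P)
    (hdim : Module.finrank ℝ (Submodule.span ℝ (R : Set E)) = 2) {r s : E} (hr : r ∈ R)
    (hs : s ∈ R) : hyperplaneReflection r s ∈ R := by
  obtain ⟨c, u, hcr, hur, -, h⟩ := hR.1.exists_wall hr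
  have hcr' : ⟪c, -r⟫ = 0 := by rw [inner_neg_right, hcr, neg_zero]
  have hur' : 0 < ⟪-u, -r⟫ := by rwa [inner_neg_neg]
  have h' : ∀ s ∈ R, s ≠ -r → s ≠ - -r → |⟪-u, s⟫| < |⟪c, s⟫| := by
    intro s hs h1 h2
    rw [inner_neg_left, abs_neg]
    exact h s hs (by simpa using h2) h1
  obtain ⟨A, hA, hAv⟩ := hP.exists_map_posSum_eq hR (isRegularFor_add hcr' hur' h')
    (isRegularFor_add hcr hur h)
  exact hyperplaneReflection_mem_of_map_posSum hR.1 hdim hr hcr hur h hA hAv s hs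

theorem isRootSystem_of_forall_mem {R : Finset E} (hR0 : (0 : E) ∉ R)
    (h : ∀ r ∈ R, ∀ s ∈ R, hyperplaneReflection r s ∈ R) : IsRootSystem (R : Set E) :=
  ⟨R.finite_toSet, hR0, fun r hr ↦ (bijOn_of_forall_mem _ (h r hr)).image_eq⟩

end Planar

/-! ### The Weyl group of a reduced root system acts regularly on the chambers. -/

section WeylGroup

variable {E : Type*} [NormedAddCommGroup E] [InnerProductSpace ℝ E]

/-- The reflection in the positive element `s` permutes the other positive elements, that is,
`s` is a simple root. -/
def IsSimpleFor (R : Finset E) (c s : E) : Prop :=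
  s ∈ R ∧ 0 < ⟪c, s⟫ ∧ ∀ r ∈ R, 0 < ⟪c, r⟫ → r ≠ s → 0 < ⟪c, hyperplaneReflection s r⟫

/-- A vector that is nonnegative on the simple roots is nonnegative on all positive roots. -/
theorem inner_nonneg_of_isSimpleFor {R : Finset E} (hR : IsReducedSet R)
    (hroot : ∀ r ∈ R, ∀ s ∈ R, hyperplaneReflection r s ∈ R) {c x : E} (hc : IsRegularFor R c)
    (hx : ∀ s, IsSimpleFor R c s → 0 ≤ ⟪x, s⟫) : ∀ r ∈ R, 0 < ⟪c, r⟫ → 0 ≤ ⟪x, r⟫ := by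
  classical
  intro q hq hqc
  by_contra! hqx
  have hmem : ∀ r, r ∈ R.filter (fun r ↦ 0 < ⟪c, r⟫) ↔ r ∈ R ∧ 0 < ⟪c, r⟫ := fun r ↦
    Finset.mem_filter
  -- Two extremal choices replace the expansion of positive roots in simple roots: minimise `⟪x, r⟫
  -- / ⟪c, r⟫`, then among the minimisers maximise `‖r‖ / ⟪c, r⟫`. The result `s` turns out to be
  -- simple although `⟪x, s⟫ < 0`.
  obtain ⟨p, hp, hmin⟩ := (R.filter fun r ↦ 0 < ⟪c, r⟫).exists_min_image
    (fun r ↦ ⟪x, r⟫ / ⟪c, r⟫) ⟨q, (hmem q).2 ⟨hq, hqc⟩⟩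
  obtain ⟨hpR, hpc⟩ := (hmem p).1 hp
  set μ := ⟪x, p⟫ / ⟪c, p⟫ with hμ
  have hμ0 : μ < 0 := (hmin q ((hmem q).2 ⟨hq, hqc⟩)).trans_lt (div_neg_of_neg_of_pos hqx hqc)
  have hmin' : ∀ r ∈ R, 0 < ⟪c, r⟫ → μ * ⟪c, r⟫ ≤ ⟪x, r⟫ := fun r hr hrc ↦
    (le_div_iff₀ hrc).1 (hmin r ((hmem r).2 ⟨hr, hrc⟩))
  have hmem' : ∀ r, r ∈ (R.filter fun r ↦ 0 < ⟪c, r⟫ ∧ ⟪x, r⟫ = μ * ⟪c, r⟫) ↔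
      r ∈ R ∧ 0 < ⟪c, r⟫ ∧ ⟪x, r⟫ = μ * ⟪c, r⟫ := fun r ↦ Finset.mem_filter
  obtain ⟨s, hs, hmax⟩ := (R.filter fun r ↦ 0 < ⟪c, r⟫ ∧ ⟪x, r⟫ = μ * ⟪c, r⟫).exists_max_image
    (fun r ↦ ‖r‖ / ⟪c, r⟫) ⟨p, (hmem' p).2 ⟨hpR, hpc, by rw [hμ, div_mul_cancel₀ _ hpc.ne']⟩⟩
  obtain ⟨hsR, hsc, hsx⟩ := (hmem' s).1 hs
  set M := ‖s‖ / ⟪c, s⟫ with hM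
  have hMs : ‖s‖ = M * ⟪c, s⟫ := by rw [hM, div_mul_cancel₀ _ hsc.ne']
  have hmax' : ∀ r ∈ R, 0 < ⟪c, r⟫ → ⟪x, r⟫ = μ * ⟪c, r⟫ → ‖r‖ ≤ M * ⟪c, r⟫ :=
    fun r hr hrc hrx ↦ (div_le_iff₀ hrc).1 (hmax r ((hmem' r).2 ⟨hr, hrc, hrx⟩))
  have hns : ¬ IsSimpleFor R c s := fun h ↦ by
    have := hx s h
    rw [hsx] at this
    nlinarith
  rw [IsSimpleFor] at hns
  push Not at hns
  obtain ⟨r, hr, hrc, hrs, hTr⟩ := hns hsR hsc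
  -- Both `r` and `r'` are positive and their sum is `k • s`, so both attain the minimal ratio `μ`.
  set r' := -hyperplaneReflection s r with hr'def
  have hr' : r' ∈ R := hR.neg_mem (hroot s hsR r hr)
  have hrc' : 0 < ⟪c, r'⟫ := by
    rw [hr'def, inner_neg_right]
    exact neg_pos.2 (lt_of_le_of_ne hTr (hc _ (hroot s hsR r hr)))
  set k := 2 * ⟪s, r⟫ / ⟪s, s⟫
  have hsum : r + r' = k • s := by
    rw [hr'def, hyperplaneReflection_apply]
    module
  have hck : ⟪c, r⟫ + ⟪c, r'⟫ = k * ⟪c, s⟫ := by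
    rw [← inner_add_right, hsum, real_inner_smul_right]
  have hxk : ⟪x, r⟫ + ⟪x, r'⟫ = k * ⟪x, s⟫ := by
    rw [← inner_add_right, hsum, real_inner_smul_right]
  have hk : 0 < k := pos_of_mul_pos_left (hck ▸ add_pos hrc hrc') hsc.le
  have h1 := hmin' r hr hrc
  have h2 := hmin' r' hr' hrc'
  have h3 : k * ⟪x, s⟫ = μ * ⟪c, r⟫ + μ * ⟪c, r'⟫ := by
    rw [hsx, ← mul_add, hck]
    ring
  have hn := hmax' r hr hrc (by linarith)
  have hn' := hmax' r' hr' hrc' (by linarith)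
  have hnorm : ‖r + r'‖ = M * ⟪c, r⟫ + M * ⟪c, r'⟫ := by
    rw [hsum, norm_smul, Real.norm_of_nonneg hk.le, hMs, ← mul_add, hck]
    ring
  -- Maximality of `M` bounds `‖r‖ + ‖r'‖` by `‖r + r'‖`, so the triangle inequality is an equality.
  -- As the norms are equal, `r = r'` is parallel to `s`, and reducedness leaves only `s` and `-s`.
  have hray : SameRay ℝ r r' := sameRay_iff_norm_add.2 (by linarith [norm_add_le r r'])
  have heq : r = r' := (sameRay_iff_of_norm_eq (by
    rw [hr'def, norm_neg, LinearIsometryEquiv.norm_map])).1 hray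
  have hspan : r ∈ Submodule.span ℝ {s} := by
    refine Submodule.mem_span_singleton.2 ⟨k / 2, ?_⟩
    rw [← heq] at hsum
    rw [div_eq_inv_mul, mul_smul, ← hsum, ← two_smul ℝ r, smul_smul]
    norm_num
  rcases (hR.mem_span_iff hsR r).1 ⟨hr, hspan⟩ with h | h
  · exact hrs h
  · rw [h, inner_neg_right] at hrc
    linarith

/-- A finite group that contains the simple reflections moves any chamber to the given one. -/
theorem exists_forall_pos_inner_apply {R : Finset E} (hR : IsReducedSet R)
    (hroot : ∀ r ∈ R, ∀ s ∈ R, hyperplaneReflection r s ∈ R) {c c' : E} (hc : IsRegularFor R c)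
    (hc' : IsRegularFor R c') (H : Subgroup (E ≃ₗᵢ[ℝ] E)) [Finite H]
    (hH : ∀ g ∈ H, ∀ r ∈ R, g r ∈ R) (hs : ∀ s, IsSimpleFor R c s → hyperplaneReflection s ∈ H) :
    ∃ g ∈ H, ∀ r ∈ R, 0 < ⟪c, r⟫ → 0 < ⟪g c', r⟫ := by
  -- If `g c'` were negative on a simple root `s`, reflecting it in `s` would increase the inner
  -- product with `c`.
  obtain ⟨⟨g, hg⟩, hmax⟩ := Finite.exists_max fun g : H ↦ ⟪c, g.1 c'⟫
  refine ⟨g, hg, fun r hr hrc ↦ lt_of_le_of_ne ?_ (hc'.map (hH g hg) r hr).symm⟩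
  refine inner_nonneg_of_isSimpleFor hR hroot hc (fun s hsimple ↦ ?_) r hr hrc
  have h1 : ⟪c, hyperplaneReflection s (g c')⟫ ≤ ⟪c, g c'⟫ :=
    hmax ⟨_, H.mul_mem (hs s hsimple) hg⟩
  rw [hyperplaneReflection_apply, inner_sub_right, real_inner_smul_right] at h1
  have h2 : 0 < ⟪s, s⟫ := real_inner_self_pos.2 (hR.ne_zero hsimple.1)
  rw [real_inner_comm]
  by_contra! h3
  have h4 : 2 * ⟪s, g c'⟫ / ⟪s, s⟫ < 0 := div_neg_of_neg_of_pos (by linarith) h2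
  nlinarith [hsimple.2.1]

theorem forall_mem_of_mem_weylGroup {R : Finset E}
    (hroot : ∀ r ∈ R, ∀ s ∈ R, hyperplaneReflection r s ∈ R) :
    ∀ g ∈ weylGroup (R : Set E), ∀ r ∈ R, g r ∈ R := by
  intro g hg
  rw [weylGroup] at hg
  induction hg using Subgroup.closure_induction with
  | mem g hg =>
    obtain ⟨r, hr, rfl⟩ := hg
    exact hroot r hr
  | one => exact fun r hr ↦ hr
  | mul g h _ _ hg hh => exact fun r hr ↦ hg _ (hh r hr)
  | inv g _ hg => exact inv_mem_of_forall_mem hg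

theorem apply_eq_self_of_mem_weylGroup {R : Set E} {g : E ≃ₗᵢ[ℝ] E} (hg : g ∈ weylGroup R) {x : E}
    (hx : x ∈ (Submodule.span ℝ R)ᗮ) : g x = x := by
  rw [weylGroup] at hg
  induction hg using Subgroup.closure_induction with
  | mem g hg =>
    obtain ⟨r, hr, rfl⟩ := hg
    exact hyperplaneReflection_of_inner_eq_zero
      (Submodule.inner_right_of_mem_orthogonal (Submodule.subset_span hr) hx)
  | one => rfl
  | mul g h _ _ hg hh => exact (congrArg g hh).trans hg
  | inv g _ hg => exact (congrArg (⇑(g⁻¹)) hg).symm.trans (g.symm_apply_apply x)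

/-- An element of the group permutes `R` and fixes the orthogonal complement of its span, so it is
determined by its action on the finite set `R`. -/
theorem finite_weylGroup {R : Finset E}
    (hroot : ∀ r ∈ R, ∀ s ∈ R, hyperplaneReflection r s ∈ R) :
    Finite (weylGroup (R : Set E)) := by
  let f : weylGroup (R : Set E) → (R → R) := fun g r ↦
    ⟨g.1 r.1, forall_mem_of_mem_weylGroup hroot g.1 g.2 r.1 r.2⟩
  refine Finite.of_injective f fun g h hgh ↦ Subtype.ext (LinearIsometryEquiv.ext fun x ↦ ?_)
  have : FiniteDimensional ℝ (Submodule.span ℝ (R : Set E)) :=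
    FiniteDimensional.span_of_finite ℝ R.finite_toSet
  obtain ⟨y, hy, z, hz, rfl⟩ :=
    (Submodule.span ℝ (R : Set E)).exists_add_mem_mem_orthogonal x
  have hspan : Set.EqOn g.1.toLinearEquiv.toLinearMap h.1.toLinearEquiv.toLinearMap
      (Submodule.span ℝ (R : Set E)) :=
    LinearMap.eqOn_span fun r hr ↦ congrArg Subtype.val (congrFun hgh ⟨r, hr⟩)
  rw [map_add, map_add, apply_eq_self_of_mem_weylGroup g.2 hz,
    apply_eq_self_of_mem_weylGroup h.2 hz]
  exact congrArg (· + z) (hspan hy)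

/-- The Weyl group is generated by the simple reflections. -/
theorem weylGroup_le_closure_isSimpleFor {R : Finset E} (hR : IsReducedSet R)
    (hroot : ∀ r ∈ R, ∀ s ∈ R, hyperplaneReflection r s ∈ R) {c : E} (hc : IsRegularFor R c) :
    weylGroup (R : Set E) ≤ weylGroup {s | IsSimpleFor R c s} := by
  set H := weylGroup {s | IsSimpleFor R c s} with hH
  have hle : H ≤ weylGroup (R : Set E) := Subgroup.closure_mono (Set.image_mono fun s hs ↦ hs.1)
  have hHR : ∀ g ∈ H, ∀ r ∈ R, g r ∈ R := fun g hg ↦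
    forall_mem_of_mem_weylGroup hroot g (hle hg)
  have hfin := finite_weylGroup hroot
  have : Finite H := Finite.of_injective _ (Subgroup.inclusion_injective hle)
  have hsH : ∀ s, IsSimpleFor R c s → hyperplaneReflection s ∈ H := fun s hs ↦
    Subgroup.subset_closure (Set.mem_image_of_mem _ hs)
  rw [weylGroup, Subgroup.closure_le]
  rintro _ ⟨r, hr, rfl⟩
  -- The group `H` moves the chamber of `c₀ + u`, which is adjacent to the wall of `r`, to the
  -- chamber of `c`. There the image of `r` is simple, and the reflection in `r` is conjugate by `H`
  -- to a simple one.
  obtain ⟨c₀, u, hcr, hur, hTc, hwall⟩ := hR.exists_wall hr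
  have hpos := pos_inner_add_iff hcr hur hwall
  have hreg := isRegularFor_add hcr hur hwall
  obtain ⟨g, hg, hgc⟩ := exists_forall_pos_inner_apply hR hroot hc hreg H hHR hsH
  have hiff := pos_iff_of_forall_pos (fun _ ↦ hR.neg_mem) hc hgc
  have hsimple : IsSimpleFor R c (g r) := by
    refine ⟨hHR g hg r hr, ?_, fun q hq hqc hqr ↦ ?_⟩
    · rw [hiff _ (hHR g hg r hr), g.inner_map_map, hpos r hr]
      exact Or.inl rfl
    · obtain ⟨q, hq', rfl⟩ := (bijOn_of_forall_mem g (hHR g hg)).surjOn hq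
      have hT : hyperplaneReflection (g r) (g q) = g (hyperplaneReflection r q) := by
        rw [hyperplaneReflection_map]
        exact congrArg (fun x ↦ g (hyperplaneReflection r x)) (g.symm_apply_apply q)
      rw [hiff _ hq, g.inner_map_map, hpos q hq'] at hqc
      have hqc' := hqc.resolve_left fun h ↦ hqr (h ▸ rfl)
      rw [hT, hiff _ (hHR g hg _ (hroot r hr q hq')), g.inner_map_map, hpos _ (hroot r hr q hq'),
        -- The reflection in `r` fixes `c₀`, so it preserves the sign of every element on `c₀`.
        ← inner_hyperplaneReflection, hTc]
      exact Or.inr hqc'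
  have h1 : hyperplaneReflection r = g⁻¹ * hyperplaneReflection (g r) * g := by
    rw [hyperplaneReflection_map]
    group
  rw [SetLike.mem_coe, h1]
  exact H.mul_mem (H.mul_mem (H.inv_mem hg) (hsH _ hsimple)) hg

/-- The exchange condition. -/
theorem exists_exchange {R : Finset E} (hroot : ∀ r ∈ R, ∀ s ∈ R, hyperplaneReflection r s ∈ R)
    {c b : E} (hb : IsSimpleFor R c b) (l : List E) (hl : ∀ a ∈ l, IsSimpleFor R c a)
    (hlb : ¬ 0 < ⟪c, (l.map hyperplaneReflection).prod b⟫) :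
    ∃ l' : List E, (∀ a ∈ l', IsSimpleFor R c a) ∧ l'.length + 1 = l.length ∧
      (l'.map hyperplaneReflection).prod
        = (l.map hyperplaneReflection).prod * hyperplaneReflection b := by
  induction l with
  | nil => exact absurd hb.2.1 hlb
  | cons a l ih =>
    have ha := hl a List.mem_cons_self
    have hl' : ∀ a ∈ l, IsSimpleFor R c a := fun a h ↦ hl a (List.mem_cons_of_mem _ h)
    set w := (l.map hyperplaneReflection).prod with hw
    have hwW : w ∈ weylGroup (R : Set E) := by
      refine Subgroup.list_prod_mem _ fun g hg ↦ ?_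
      obtain ⟨s, hs, rfl⟩ := List.mem_map.1 hg
      exact Subgroup.subset_closure (Set.mem_image_of_mem _ (hl' s hs).1)
    rw [List.map_cons, List.prod_cons, ← hw] at hlb ⊢
    by_cases h : 0 < ⟪c, w b⟫
    · have hwb : w b = a := by
        by_contra hne
        exact hlb (ha.2.2 _ (forall_mem_of_mem_weylGroup hroot w hwW b hb.1) h hne)
      refine ⟨l, hl', rfl, ?_⟩
      rw [← hwb, hyperplaneReflection_map, inv_mul_cancel_right, mul_assoc,
        hyperplaneReflection_mul_self, mul_one]
    · obtain ⟨l', h1, h2, h3⟩ := ih hl' h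
      refine ⟨a :: l', fun x hx ↦ ?_, by simp [h2], ?_⟩
      · rcases List.mem_cons.1 hx with rfl | hx
        exacts [ha, h1 x hx]
      · rw [List.map_cons, List.prod_cons, h3, mul_assoc]

/-- If the word ends in `b`, the product without this letter makes `b` negative. The exchange
condition then yields a word for the same element that is shorter by two letters. -/
theorem prod_eq_one_of_forall_pos {R : Finset E}
    (hroot : ∀ r ∈ R, ∀ s ∈ R, hyperplaneReflection r s ∈ R) {c : E} (n : ℕ) (l : List E)
    (hn : l.length = n) (hl : ∀ a ∈ l, IsSimpleFor R c a)
    (hpos : ∀ b, IsSimpleFor R c b → 0 < ⟪c, (l.map hyperplaneReflection).prod b⟫) :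
    (l.map hyperplaneReflection).prod = 1 := by
  induction n using Nat.strong_induction_on generalizing l with
  | _ n ih =>
    rcases List.eq_nil_or_concat l with rfl | ⟨l₁, b, rfl⟩
    · simp
    rw [List.concat_eq_append] at *
    have hb : IsSimpleFor R c b := hl b (by simp)
    have hprod : ((l₁ ++ [b]).map hyperplaneReflection).prod
        = (l₁.map hyperplaneReflection).prod * hyperplaneReflection b := by simp
    have hneg : ¬ 0 < ⟪c, (l₁.map hyperplaneReflection).prod b⟫ := by
      have h1 : 0 < ⟪c, (l₁.map hyperplaneReflection).prod (hyperplaneReflection b b)⟫ := by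
        have := hpos b hb
        rwa [hprod] at this
      rw [hyperplaneReflection_self, map_neg, inner_neg_right] at h1
      linarith
    obtain ⟨l', h1, h2, h3⟩ := exists_exchange hroot hb l₁ (fun a ha ↦ hl a (by simp [ha])) hneg
    rw [← hprod] at h3
    rw [← h3]
    refine ih l'.length ?_ l' rfl h1 (by rwa [h3])
    rw [← hn, List.length_append, ← h2]
    simp

/-- The Weyl group acts freely on the chambers. -/
theorem eq_one_of_mem_weylGroup {R : Finset E} (hR : IsReducedSet R)
    (hroot : ∀ r ∈ R, ∀ s ∈ R, hyperplaneReflection r s ∈ R) {c : E} (hc : IsRegularFor R c)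
    {g : E ≃ₗᵢ[ℝ] E} (hg : g ∈ weylGroup (R : Set E))
    (hpos : ∀ r ∈ R, 0 < ⟪c, r⟫ → 0 < ⟪c, g r⟫) : g = 1 := by
  obtain ⟨l, hl, rfl⟩ : ∃ l : List E, (∀ a ∈ l, IsSimpleFor R c a) ∧
      (l.map hyperplaneReflection).prod = g := by
    have hg' := weylGroup_le_closure_isSimpleFor hR hroot hc hg
    clear hpos hg
    rw [weylGroup] at hg'
    induction hg' using Subgroup.closure_induction with
    | mem g hg =>
      obtain ⟨s, hs, rfl⟩ := hg
      exact ⟨[s], by simpa using hs, by simp⟩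
    | one => exact ⟨[], by simp, by simp⟩
    | mul g h _ _ hg hh =>
      obtain ⟨l, hl, rfl⟩ := hg
      obtain ⟨l', hl', rfl⟩ := hh
      refine ⟨l ++ l', fun a ha ↦ ?_, by simp⟩
      exact (List.mem_append.1 ha).elim (hl a) (hl' a)
    | inv g _ hg =>
      obtain ⟨l, hl, rfl⟩ := hg
      refine ⟨l.reverse, fun a ha ↦ hl a (List.mem_reverse.1 ha), ?_⟩
      rw [List.prod_inv_reverse, List.map_map, List.map_reverse]
      simp only [Function.comp_def, hyperplaneReflection_inv]
  exact prod_eq_one_of_forall_pos hroot _ l rfl hl fun b hb ↦ hpos b hb.1 hb.2.1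

/-- The zonotope generated by a reduced root system is a permutahedron of the Weyl group. -/
theorem isPermutahedron_zon [FiniteDimensional ℝ E] {R : Finset E} (hR : IsReducedSet R)
    (hroot : ∀ r ∈ R, ∀ s ∈ R, hyperplaneReflection r s ∈ R) :
    IsPermutahedron (weylGroup (R : Set E)) (zon R) := by
  have hfin := finite_weylGroup hroot
  have hW := forall_mem_of_mem_weylGroup hroot
  have hvert : ∀ v, v ∈ (zon R).extremePoints ℝ ↔ ∃ c, IsRegularFor R c ∧ v = posSum R c := by
    intro v
    have := mem_extremePoints_vadd_zon_iff (t := 0) (v := v) hR.1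
    simpa only [zero_vadd, zero_add] using this
  refine ⟨?_, ⟨hfin, R, R.finite_toSet, hR.1, rfl⟩, fun T hT v hv ↦ ?_, fun v hv w hw ↦ ?_⟩
  · simpa using isPolytope_vadd_zon 0 R
  · obtain ⟨c, hc, rfl⟩ := (hvert v).1 hv
    exact (hvert _).2 ⟨T c, hc.map (hW T hT), map_posSum T (hW T hT) c⟩
  · obtain ⟨c, hc, rfl⟩ := (hvert v).1 hv
    obtain ⟨c', hc', rfl⟩ := (hvert w).1 hw
    obtain ⟨g, hg, hgc⟩ := exists_forall_pos_inner_apply hR hroot hc' hc _ hW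
      fun s hs ↦ Subgroup.subset_closure (Set.mem_image_of_mem _ hs.1)
    have hgv : g (posSum R c) = posSum R c' := by
      rw [map_posSum g (hW g hg)]
      exact (posSum_congr (pos_iff_of_forall_pos (fun _ ↦ hR.neg_mem) hc' hgc)).symm
    refine ⟨g, ⟨hg, hgv⟩, fun h ⟨hh, hhv⟩ ↦ ?_⟩
    -- `g⁻¹ * h` fixes a vertex, hence preserves the chamber of `c`, hence is trivial.
    have hk : g⁻¹ * h ∈ weylGroup (R : Set E) := mul_mem (inv_mem hg) hh
    have hkv : (g⁻¹ * h) (posSum R c) = posSum R c := by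
      change g⁻¹ (h (posSum R c)) = _
      rw [hhv, ← hgv]
      exact g.symm_apply_apply _
    rw [map_posSum _ (hW _ hk)] at hkv
    have hiff := pos_iff_of_posSum_eq (hc.map (hW _ hk)) hkv
    have h1 := eq_one_of_mem_weylGroup hR hroot hc hk fun r hr hrc ↦ by
      rwa [← hiff _ (hW _ hk r hr), LinearIsometryEquiv.inner_map_map]
    exact (inv_mul_eq_one.1 h1).symm

/-- If all flats of dimension two are invariant under their reflections, so is the whole set. -/
theorem hyperplaneReflection_mem_of_forall_flat {R : Finset E} (hR : IsReducedSet R)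
    (h : ∀ F : Set E, IsFlatOf F R → Module.finrank ℝ (Submodule.span ℝ F) = 2 →
      ∀ r ∈ F, ∀ s ∈ F, hyperplaneReflection r s ∈ R) :
    ∀ r ∈ R, ∀ s ∈ R, hyperplaneReflection r s ∈ R := by
  intro r hr s hs
  -- Parallel elements span no plane, but for them `s` is `r` or `-r`, and the reflection swaps
  -- these two.
  by_cases hrs : s ∈ Submodule.span ℝ {r}
  · rcases (hR.mem_span_iff hr s).1 ⟨hs, hrs⟩ with rfl | rfl
    · rw [hyperplaneReflection_self]
      exact hR.neg_mem hs
    · rwa [map_neg, hyperplaneReflection_self, neg_neg]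
  set F : Set E := (R : Set E) ∩ Submodule.span ℝ {r, s} with hF
  have hrF : r ∈ F := ⟨hr, Submodule.subset_span (by simp)⟩
  have hsF : s ∈ F := ⟨hs, Submodule.subset_span (by simp)⟩
  have hspan : Submodule.span ℝ F = Submodule.span ℝ {r, s} := by
    apply le_antisymm
    · exact Submodule.span_le.2 Set.inter_subset_right
    · refine Submodule.span_mono ?_
      rintro x (rfl | rfl)
      exacts [hrF, hsF]
  have hli : LinearIndependent ℝ ![r, s] := by
    rw [LinearIndependent.pair_iff' (hR.ne_zero hr)]
    intro a ha
    exact hrs (ha ▸ Submodule.smul_mem _ a (Submodule.mem_span_singleton_self r))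
  refine h F ⟨Set.inter_subset_left, fun x hx ↦ ⟨hx.1, hspan ▸ hx.2⟩⟩ ?_ r hrF s hsF
  have := finrank_span_eq_card hli
  rwa [Matrix.range_cons, Matrix.range_cons, Matrix.range_empty, Set.union_empty,
    Set.singleton_union, ← hspan, Fintype.card_fin] at this

/-- `zon R` is itself symmetric because `R = -R`. So the symmetry of `Z` makes the translations by
`t` and `-t` agree on it, and `t = 0`. -/
theorem IsReducedGeneratingSet.eq_zon_of_neg_eq {R : Finset E} {Z : Set E}
    (hR : IsReducedGeneratingSet R Z) (hZ : -Z = Z) : Z = zon R := by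
  obtain ⟨hred, t, rfl⟩ := hR
  have h1 : -zon R = zon R := by
    rw [← Set.image_neg_eq_neg]
    exact image_zon_of_forall_mem (LinearIsometryEquiv.neg ℝ) fun r hr ↦ hred.neg_mem hr
  have h2 : -(t +ᵥ zon R) = -t +ᵥ zon R := by
    nth_rewrite 2 [← h1]
    rw [← Set.image_neg_eq_neg, ← Set.image_neg_eq_neg, ← Set.image_vadd, ← Set.image_vadd,
      Set.image_image, Set.image_image]
    simp only [vadd_eq_add, neg_add]
  have h3 : t = -t := vadd_zon_injective R (hZ.symm.trans h2)
  have h4 : t = 0 := by_contra fun h0 ↦ ne_neg_self_of_ne_zero h0 h3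
  rw [h4, zero_vadd]

end WeylGroup

theorem mainTheorem3 (d : ℕ) :
    -- if all 2-faces of a zonotope centred at the origin are vertex-transitive, then its generators
    -- form a root system, and it is a permutahedron of the Weyl group of this root system
    (∀ Z : Set (EuclideanSpace ℝ (Fin d)), IsZonotope Z → -Z = Z →
      (∀ σ, IsFaceOfDim 2 σ Z → IsVertexTransitive σ) →
        IsRootSystem (zonGen Z) ∧ IsPermutahedron (weylGroup (zonGen Z)) Z) ∧
    -- each 2-dimensional flat of generators of a zonotope is the set of generators of a 2-face
    (∀ Z : Set (EuclideanSpace ℝ (Fin d)), IsZonotope Z →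
      ∀ F, IsFlatOf F (zonGen Z) → Module.finrank ℝ (Submodule.span ℝ F) = 2 →
        ∃ σ, IsFaceOfDim 2 σ Z ∧ zonGen σ = F) ∧
    -- the generators of a vertex-transitive 2-dimensional zonotope form a 2-dimensional root system
    (∀ P : Set (EuclideanSpace ℝ (Fin d)), IsZonotope P → affineDim P = 2 →
      IsVertexTransitive P →
        IsRootSystem (zonGen P) ∧ Module.finrank ℝ (Submodule.span ℝ (zonGen P)) = 2) := by
  refine ⟨fun Z hZ hneg hface ↦ ?_, fun Z hZ F hF hdim ↦ ?_, fun P hP hdim hvt ↦ ?_⟩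
  · obtain ⟨R, hR⟩ := hZ.exists_reducedGeneratingSet
    have hroot : ∀ r ∈ R, ∀ s ∈ R, hyperplaneReflection r s ∈ R := by
      refine hyperplaneReflection_mem_of_forall_flat hR.1 fun F hF hdim r hr s hs ↦ ?_
      obtain ⟨σ, hσ, G, rfl, hG⟩ := exists_face_of_isFlatOf hR hF
      rw [hdim] at hσ
      exact hF.1 ((hface σ hσ).hyperplaneReflection_mem hG hdim hr hs)
    rw [zonGen_eq hR]
    refine ⟨isRootSystem_of_forall_mem hR.1.1 hroot, ?_⟩
    rw [hR.eq_zon_of_neg_eq hneg]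
    exact isPermutahedron_zon hR.1 hroot
  · obtain ⟨R, hR⟩ := hZ.exists_reducedGeneratingSet
    rw [zonGen_eq hR] at hF
    obtain ⟨σ, hσ, G, rfl, hG⟩ := exists_face_of_isFlatOf hR hF
    rw [hdim] at hσ
    exact ⟨σ, hσ, zonGen_eq hG⟩
  · obtain ⟨R, hR⟩ := hP.exists_reducedGeneratingSet
    have hspan : Module.finrank ℝ (Submodule.span ℝ (R : Set (EuclideanSpace ℝ (Fin d)))) = 2 := by
      obtain ⟨-, t, rfl⟩ := hR
      rwa [affineDim, vectorSpan_vadd_zon] at hdim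
    rw [zonGen_eq hR]
    exact ⟨isRootSystem_of_forall_mem hR.1.1 fun r hr s hs ↦
      hvt.hyperplaneReflection_mem hR hspan hr hs, hspan⟩
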